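/- Setting. CminorSel is a structured imperative language: pure expressions $a$ (local variables, machine operators, memory loads, conditional expressions $ce\,?\,a_1:a_2$), condition expressions $ce$, and statements (skip, assignment, memory store, call, tail call, return, sequence, if, loop, block, exit, switch, labelled statement, goto). Its states are regular states $\mathcal S(F,s,k,\sigma,E,M)$ (function, statement, continuation, stack block, local environment, memory), call states $\mathcal C(Fd,\vec v,k,M)$ and return states $\mathcal R(v,k,M)$, where continuations are $k ::= \mathtt{stop}\mid s;k\mid \mathtt{endblock}(k)\mid\mathtt{returnto}(id^?,F,\sigma,E,k)$. RTL represents a function body by a control-flow graph (CFG) $g$, a finite map from nodes to instructions over pseudo-registers. Its states are $\mathcal S(\Sigma,g,\sigma,l,R,M)$, $\mathcal C(\Sigma,Fd,\vec v,M)$, $\mathcal R(\Sigma,v,M)$, where $\Sigma$ is a list of frames $\mathcal F(r,g,\sigma,l,R)$. Both languages have small-step semantics $G\vdash S\xrightarrow{t}S'$, in which $t$ is a finite trace of external calls (a tail call and a return free the current stack block); $\xrightarrow{t}{}^{+}$ and $\xrightarrow{t}{}^{*}$ denote one or more, resp. zero or more, steps. $P\Downarrow B$ means that $P$ has behavior $B$: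 convergence with a finite trace and an exit code, divergence with a finite or infinite trace, or going wrong with a finite trace. Acceptable translation. $g,\gamma,\pi\vdash a\ \mathtt{in}\ r_d\sim l_1,l_2$ is the inductive predicate stating that the sub-graph of $g$ from $l_1$ to $l_2$ is a syntactic decomposition of $a$, with result in $r_d$, in which every temporary register used as a destination lies outside ${\rm Rng}(\gamma)\cup\pi$. Similarly $g,\gamma,\pi\vdash ce\sim l_1,l_{true},l_{false}$ for conditions, and $g,\gamma\vdash s\sim l_1,l_2,l_e,l_g,l_r,r_r^?$ for statements: $s$ starts at $l_1$ and branches to $l_2$ on normal termination, to $l_e(n)$ on $\mathtt{exit}(n)$, to $l_g(lbl)$ on $\mathtt{goto}\ lbl$, and to $l_r$ on return, with the result in $r_r^?$. (A $\mathtt{switch}$ is implemented by a binary decision tree that selects the same exit as its table for every integer.) An RTL function $F'$ is an acceptable translation of $F$ if it has the same signature and stack size and there are $\gamma,l_g,l,r_r^?$ such that: $\gamma$ is an injective map from the declared variables of $F$ to registers; $F'.\mathtt{code},\gamma\vdash F.\mathtt{body}\sim F'.\mathtt{entrypoint},l,\epsilon,l_g,l,r_r^?$; node $l$ contains $\mathtt{return}(r_r^?)$,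 and $r_r^?$ is present iff $F$ has a non-void result type; each parameter $x$ of $F$ is received in register $\gamma(x)$ (or, if a local variable of the same name hides it, in a register outside ${\rm Rng}(\gamma)$). $P'$ is an acceptable translation of $P$ if it has the same global variables and the same main function name, and its functions are, in order and under the same names, acceptable translations of those of $P$ (external functions being unchanged). Simulation relation. Write $\gamma\vdash E\sim R$ if $E(x)=R(\gamma(x))$ for all $x\in{\rm Dom}(\gamma)$. Write $\mathrm{TrBody}(F,g,\gamma,l_g,l_r,r_r^?)$ if $\gamma$ is injective, $g,\gamma\vdash F.\mathtt{body}\sim l_0,l_r,\epsilon,l_g,l_r,r_r^?$ for some $l_0$, $g(l_r)=\mathtt{return}(r_r^?)$, and $r_r^?$ is present iff $F$ has a non-void result type. Two relations are defined by mutual induction, for fixed $l_g,l_r,r_r^?$ within one function. (i) $g,\gamma\vdash k\sim l_2,l_e,l_g,l_r,r_r^?,\Sigma$ holds for $k=s;k'$ if $g,\gamma\vdash s\sim l_2,l,l_e,\ldots$ and $g,\gamma\vdash k'\sim l,l_e,\ldots,\Sigma$ for some $l$; for $k=\mathtt{endblock}(k')$ if $l_e=l_2.l_e'$ and $g,\gamma\vdash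 k'\sim l_2,l_e',\ldots,\Sigma$; for $k=\mathtt{stop}$ or $\mathtt{returnto}(\ldots)$ if $l_2=l_r$, $l_e=\epsilon$, $g(l_r)=\mathtt{return}(r_r^?)$ and $k\sim\Sigma$. (ii) $\mathtt{stop}\sim\epsilon$; and $\mathtt{returnto}(id^?,F,\sigma,E,k)\sim\mathcal F(r,g,\sigma,l,R).\Sigma$ if, for some $\gamma,l_g,l_r,r_r^?,l_2,l_e$, $\mathrm{TrBody}(F,g,\gamma,l_g,l_r,r_r^?)$, $\gamma\vdash E\sim R$, the code of $g$ from $l$ to $l_2$ transfers $r$ to the register of $id^?$ (if any), and $g,\gamma\vdash k\sim l_2,l_e,l_g,l_r,r_r^?,\Sigma$. Then: - $\mathcal S(F,s,k,\sigma,E,M)\sim\mathcal S(\Sigma,g,\sigma,l_1,R,M)$ if, for some $\gamma,l_2,l_e,l_g,l_r,r_r^?$, $\mathrm{TrBody}(F,g,\gamma,l_g,l_r,r_r^?)$, $g,\gamma\vdash s\sim l_1,l_2,l_e,l_g,l_r,r_r^?$, $g,\gamma\vdash k\sim l_2,l_e,l_g,l_r,r_r^?,\Sigma$ and $\gamma\vdash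 E\sim R$; - $\mathcal C(Fd,\vec v,k,M)\sim\mathcal C(\Sigma,Fd',\vec v,M)$ if $Fd'$ is an acceptable translation of $Fd$ and $k\sim\Sigma$; - $\mathcal R(v,k,M)\sim\mathcal R(\Sigma,v,M)$ if $k\sim\Sigma$. Measure. $|\mathcal S(F,s,k,\sigma,E,M)|=(|s|+|k|,|s|)$, ordered lexicographically, where $|s|$ is the number of nodes of the syntax tree of $s$, $|s;k|=1+|s|+|k|$, $|\mathtt{endblock}(k)|=1+|k|$ and $|k|=0$ otherwise; the measure of call and return states is $(0,0)$. Lemma (RTL generation preservation). Let the RTL program $P'$ be an acceptable translation of the CminorSel program $P$, and let $G',G$ be their global environments. 1. If $G\vdash S_1\xrightarrow{t}S_2$ and $S_1\sim S_1'$, then either there is $S_2'$ with $G'\vdash S_1'\xrightarrow{t}{}^{+}S_2'$ and $S_2\sim S_2'$, or $|S_2|<|S_1|$ and there is $S_2'$ with $G'\vdash S_1'\xrightarrow{t}{}^{*}S_2'$ and $S_2\sim S_2'$. 2. For every behavior $B$ that is not a going-wrong behavior, $P\Downarrow B$ implies $P'\Downarrow B$. -/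

import Mathlib

namespace Compcert

/-! ### Names, machine integers and IEEE double-precision floats -/

/-- Names of global symbols and of local variables. -/
abbrev Ident := ℕ
/-- Statement labels. -/
abbrev Label := ℕ
/-- 32-bit machine integers. -/
abbrev Int32 := BitVec 32
/-- Identifiers of memory blocks: positive for data, negative for functions. -/
abbrev Block := ℤ

/-- IEEE 754 binary64 numbers, as bit patterns. -/
abbrev F64 := BitVec 64

namespace F64

def sign (f : F64) : Bool := f.msb
/-- The bits other than the sign bit. -/
def mag (f : F64) : ℕ := f.toNat % 2 ^ 63
def expo (f : F64) : ℕ := f.mag / 2 ^ 52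
def frac (f : F64) : ℕ := f.mag % 2 ^ 52
def isNaN (f : F64) : Bool := f.expo == 2047 && f.frac != 0
def isInf (f : F64) : Bool := f.expo == 2047 && f.frac == 0
def isZero (f : F64) : Bool := f.mag == 0

/-- The bit pattern with the given sign bit and the given other bits. -/
def ofSignMag (s : Bool) (m : ℕ) : F64 := BitVec.ofNat 64 ((if s then 2 ^ 63 else 0) + m)
def zero (s : Bool) : F64 := ofSignMag s 0
def inf (s : Bool) : F64 := ofSignMag s (2047 * 2 ^ 52)
def nan : F64 := ofSignMag false (2047 * 2 ^ 52 + 2 ^ 51)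

/-- The rational number denoted by a float that is neither infinite nor a NaN. -/
def toRat (f : F64) : ℚ :=
  (if f.sign then -1 else 1) *
    (if f.expo = 0 then (f.frac : ℚ) * (2 : ℚ) ^ (-1074 : ℤ)
     else ((2 ^ 52 + f.frac : ℕ) : ℚ) * (2 : ℚ) ^ ((f.expo : ℤ) - 1075))

/-- Rounding of a rational number to the nearest integer, ties to even. -/
def roundEven (x : ℚ) : ℤ :=
  let n := ⌊x⌋
  if x - n < 1 / 2 then n
  else if 1 / 2 < x - n then n + 1
  else if n % 2 = 0 then n else n + 1

/-- For `q > 0`: the pair `(m, e)` such that `m * 2 ^ e` is `q` rounded to `p` bits of precision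
with exponents `e ≥ emin` (`m = 2 ^ p` is possible after rounding up). -/
def roundPrec (p : ℕ) (emin : ℤ) (q : ℚ) : ℕ × ℤ :=
  let e := max (Int.log 2 q - ((p : ℤ) - 1)) emin
  ((roundEven (q / (2 : ℚ) ^ e)).toNat, e)

/-- Rounding of a rational number to the nearest double. The sign `s` is used for a result that
is exactly zero. In the encoding, a carry out of the significand moves to the next exponent. -/
def ofRat (s : Bool) (q : ℚ) : F64 :=
  if q = 0 then zero s
  else
    let me := roundPrec 53 (-1074) |q|
    let bits := (me.2 + 1074).toNat * 2 ^ 52 + me.1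
    if 2047 * 2 ^ 52 ≤ bits then inf (decide (q < 0)) else ofSignMag (decide (q < 0)) bits

def neg (f : F64) : F64 := ofSignMag (!f.sign) f.mag
def abs (f : F64) : F64 := ofSignMag false f.mag

def add (x y : F64) : F64 :=
  if x.isNaN || y.isNaN then nan
  else if x.isInf then (if y.isInf && x.sign != y.sign then nan else x)
  else if y.isInf then y
  else ofRat (x.sign && y.sign) (x.toRat + y.toRat)

def sub (x y : F64) : F64 := if x.isNaN || y.isNaN then nan else add x (neg y)

def mul (x y : F64) : F64 :=
  let s := x.sign != y.sign
  if x.isNaN || y.isNaN then nan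
  else if x.isInf || y.isInf then (if x.isZero || y.isZero then nan else inf s)
  else ofRat s (x.toRat * y.toRat)

def div (x y : F64) : F64 :=
  let s := x.sign != y.sign
  if x.isNaN || y.isNaN then nan
  else if x.isInf then (if y.isInf then nan else inf s)
  else if y.isInf then zero s
  else if y.isZero then (if x.isZero then nan else inf s)
  else ofRat s (x.toRat / y.toRat)

/-- Rounding to single precision, the result being again represented as a double. -/
def single (x : F64) : F64 :=
  if x.isNaN then nan
  else if x.isInf || x.isZero then x
  else
    let me := roundPrec 24 (-149) |x.toRat|
    if 255 * 2 ^ 23 ≤ (me.2 + 149).toNat * 2 ^ 23 + me.1 then inf x.sign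
    else ofRat x.sign ((if x.sign then -1 else 1) * ((me.1 : ℚ) * (2 : ℚ) ^ me.2))

/-- Truncation towards zero of a finite float. -/
def trunc? (x : F64) : Option ℤ :=
  if x.isNaN || x.isInf then none
  else some (if 0 ≤ x.toRat then ⌊x.toRat⌋ else ⌈x.toRat⌉)

def toInt32? (x : F64) : Option Int32 :=
  x.trunc?.bind fun n => if -2 ^ 31 ≤ n ∧ n < 2 ^ 31 then some (BitVec.ofInt 32 n) else none

def toUInt32? (x : F64) : Option Int32 :=
  x.trunc?.bind fun n => if 0 ≤ n ∧ n < 2 ^ 32 then some (BitVec.ofInt 32 n) else none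

/-- Numbers other than NaNs (infinities included) are ordered as the signed integers
`± mag`; the two zeros are equal. -/
def key (x : F64) : ℤ := if x.sign then -(x.mag : ℤ) else x.mag

end F64

/-! ### Types, signatures, programs -/

inductive Typ
  | int
  | float
  deriving DecidableEq

structure Signature where
  args : List Typ
  /-- `none` is `void`. -/
  res : Option Typ
  deriving DecidableEq

structure ExtFun where
  tag : Ident
  sig : Signature

/-- Function definitions, over a type `Fn` of internal functions. -/
inductive Fundef (Fn : Type)
  | internal (f : Fn)
  | external (fe : ExtFun)

inductive InitData
  | reserve (n : ℕ)
  | int8 (n : Int32)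
  | int16 (n : Int32)
  | int32 (n : Int32)
  | float32 (f : F64)
  | float64 (f : F64)

structure Program (Fn : Type) where
  vars : List (Ident × List InitData)
  functs : List (Ident × Fundef Fn)
  main : Ident

/-! ### Values and memory states -/

inductive Val
  | int (n : Int32)
  | float (f : F64)
  | ptr (b : Block) (ofs : Int32)
  | undef
  deriving DecidableEq

def Val.ofBool (b : Bool) : Val := .int (if b then 1 else 0)

/-- Memory quantities. -/
inductive Chunk
  | int8signed
  | int8unsigned
  | int16signed
  | int16unsigned
  | int32
  | float32
  | float64

def Chunk.size : Chunk → ℕ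
  | .int8signed | .int8unsigned => 1
  | .int16signed | .int16unsigned => 2
  | .int32 | .float32 => 4
  | .float64 => 8

/-- Truncation or extension of a value, as prescribed by a memory quantity. -/
def Chunk.cast : Chunk → Val → Val
  | .int8signed, .int n => .int ((n.setWidth 8).signExtend 32)
  | .int8unsigned, .int n => .int ((n.setWidth 8).setWidth 32)
  | .int16signed, .int n => .int ((n.setWidth 16).signExtend 32)
  | .int16unsigned, .int n => .int ((n.setWidth 16).setWidth 32)
  | .int32, .int n => .int n
  | .int32, .ptr b ofs => .ptr b ofs
  | .float32, .float f => .float f.single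
  | .float64, .float f => .float f
  | _, _ => .undef

/-- Contents of one byte of memory: `datum n v` is the first byte of a value `v` that was stored
with size `n`; the next `n - 1` bytes are `cont`. -/
inductive Content
  | undef
  | datum (n : ℕ) (v : Val)
  | cont
  deriving DecidableEq

structure BlockData where
  lo : ℤ
  hi : ℤ
  contents : ℤ → Content

/-- Read a value of size `n` at offset `p`. -/
def BlockData.read (B : BlockData) (n : ℕ) (p : ℤ) : Val :=
  match B.contents p with
  | .datum n' v =>
      if n' = n ∧ (List.range (n - 1)).all (fun i => B.contents (p + 1 + i) == .cont)
      then v else .undef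
  | _ => .undef

/-- Write a value of size `n` at offset `p`. -/
def BlockData.write (B : BlockData) (n : ℕ) (p : ℤ) (v : Val) : BlockData :=
  { B with contents := fun q =>
      if q = p then .datum n v
      else if p < q ∧ q < p + n then .cont
      else B.contents q }

/-- Memory states. Allocated, not yet freed blocks are mapped to their data; identifiers of blocks
are never reused. -/
structure Mem where
  blocks : ℤ → Option BlockData
  next : ℤ
  next_pos : 0 < next
  valid : ∀ b, (blocks b).isSome → 0 < b ∧ b < next

namespace Mem

def empty : Mem where
  blocks := fun _ => none
  next := 1
  next_pos := by norm_num
  valid := by simp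

def alloc (M : Mem) (lo hi : ℤ) : Block × Mem :=
  (M.next,
   { blocks := Function.update M.blocks M.next (some ⟨lo, hi, fun _ => .undef⟩)
     next := M.next + 1
     next_pos := by have := M.next_pos; omega
     valid := by
      intro b hb
      have hp := M.next_pos
      by_cases h : b = M.next
      · omega
      · rw [Function.update_of_ne h] at hb
        have := M.valid b hb
        omega })

def load (M : Mem) (κ : Chunk) (b : Block) (δ : ℤ) : Option Val :=
  match M.blocks b with
  | some B => if B.lo ≤ δ ∧ δ + κ.size ≤ B.hi then some (κ.cast (B.read κ.size δ)) else none
  | none => none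

def store (M : Mem) (κ : Chunk) (b : Block) (δ : ℤ) (v : Val) : Option Mem :=
  match hB : M.blocks b with
  | some B =>
      if B.lo ≤ δ ∧ δ + κ.size ≤ B.hi then
        some
          { blocks := Function.update M.blocks b (some (B.write κ.size δ v))
            next := M.next
            next_pos := M.next_pos
            valid := by
              intro b' hb'
              by_cases h : b' = b
              · exact M.valid b' (by rw [h, hB]; rfl)
              · rw [Function.update_of_ne h] at hb'
                exact M.valid b' hb' }
      else none
  | none => none

def free (M : Mem) (b : Block) : Mem where
  blocks := Function.update M.blocks b none
  next := M.next
  next_pos := M.next_pos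
  valid := by
    intro b' hb'
    by_cases h : b' = b
    · rw [h, Function.update_self] at hb'
      simp at hb'
    · rw [Function.update_of_ne h] at hb'
      exact M.valid b' hb'

end Mem

/-! ### Global environments and the initial memory state -/

structure Genv (Fn : Type) where
  symbol : Ident → Option Block
  funct : Block → Option (Fundef Fn)

/-- The `i`-th function (from 0) is at block `-(i + 1)`, the `j`-th variable at block `j + 1`. -/
def globalenv {Fn : Type} (P : Program Fn) : Genv Fn where
  symbol := fun id =>
    match P.functs.findIdx? (fun p => p.1 == id) with
    | some i => some (-((i : ℤ) + 1))
    | none =>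
      match P.vars.findIdx? (fun p => p.1 == id) with
      | some j => some ((j : ℤ) + 1)
      | none => none
  funct := fun b =>
    if b < 0 then (P.functs[(-b - 1).toNat]?).map Prod.snd else none

def InitData.size : InitData → ℕ
  | .reserve n => n
  | .int8 _ => 1
  | .int16 _ => 2
  | .int32 _ | .float32 _ => 4
  | .float64 _ => 8

/-- Store one item of initialization data (within bounds in all uses below). -/
def InitData.store (M : Mem) (b : Block) (δ : ℤ) : InitData → Mem
  | .reserve _ => M
  | .int8 n => (M.store .int8unsigned b δ (.int n)).getD M
  | .int16 n => (M.store .int16unsigned b δ (.int n)).getD M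
  | .int32 n => (M.store .int32 b δ (.int n)).getD M
  | .float32 f => (M.store .float32 b δ (.float f)).getD M
  | .float64 f => (M.store .float64 b δ (.float f)).getD M

def storeInitList (b : Block) : Mem → ℤ → List InitData → Mem
  | M, _, [] => M
  | M, δ, d :: ds => storeInitList b (d.store M b δ) (δ + d.size) ds

def allocVar (M : Mem) (ds : List InitData) : Mem :=
  let bM := M.alloc 0 ((ds.map InitData.size).sum : ℕ)
  storeInitList bM.1 bM.2 0 ds

def initmem {Fn : Type} (P : Program Fn) : Mem :=
  P.vars.foldl (fun M x => allocVar M x.2) Mem.empty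

/-! ### Traces, labeled transition systems, observable behaviors -/

inductive EventVal
  | int (n : Int32)
  | float (f : F64)

def EventVal.toVal : EventVal → Val
  | .int n => .int n
  | .float f => .float f

def EventVal.typ : EventVal → Typ
  | .int _ => .int
  | .float _ => .float

structure Event where
  tag : Ident
  args : List EventVal
  res : EventVal

/-- Finite traces. -/
abbrev Trace := List Event
/-- Finite or infinite traces. -/
abbrev InfTrace := Stream'.Seq Event

/-- The effect of applying an external function. A function without declared result is taken to
return an integer. -/
inductive ExtCall (fe : ExtFun) : List Val → Trace → Val → Prop
  | mk (args : List EventVal) (res : EventVal) :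
      args.map EventVal.typ = fe.sig.args →
      res.typ = fe.sig.res.getD .int →
      ExtCall fe (args.map EventVal.toVal) [⟨fe.tag, args, res⟩] res.toVal

section Transitions

variable {St : Type} (step : St → Trace → St → Prop)

/-- Zero, one or several transitions. -/
inductive Star : St → Trace → St → Prop
  | refl (S : St) : Star S [] S
  | step {S S' S'' : St} {t₁ t₂ : Trace} :
      step S t₁ S' → Star S' t₂ S'' → Star S (t₁ ++ t₂) S''

/-- One or several transitions. -/
inductive Plus : St → Trace → St → Prop
  | mk {S S' S'' : St} {t₁ t₂ : Trace} :
      step S t₁ S' → Star step S' t₂ S'' → Plus S (t₁ ++ t₂) S''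

/-- Infinite sequences of transitions: the greatest relation `X` such that `X S T` implies that
there is a transition from `S` to some `S'` with a trace `t` such that `T = t.T'` and `X S' T'`. -/
def Forever (S : St) (T : InfTrace) : Prop :=
  ∃ X : St → InfTrace → Prop, X S T ∧
    ∀ S T, X S T →
      ∃ t S' T', step S t S' ∧ T = Stream'.Seq.append (Stream'.Seq.ofList t) T' ∧ X S' T'

end Transitions

/-- The transition semantics of a program. -/
structure Semantics where
  St : Type
  step : St → Trace → St → Prop
  initial : St → Prop
  final : St → Int32 → Prop

inductive Behavior
  | converges (t : Trace) (n : Int32)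
  | diverges (T : InfTrace)
  | goeswrong (t : Trace)

def Wrong : Set Behavior := {B | ∃ t, B = .goeswrong t}

/-- `L.Behaves B`: the program with semantics `L` executes with observable behavior `B`. -/
inductive Semantics.Behaves (L : Semantics) : Behavior → Prop
  | converges {S S' : L.St} {t : Trace} {n : Int32} :
      L.initial S → Star L.step S t S' → L.final S' n → Behaves L (.converges t n)
  | diverges {S : L.St} {T : InfTrace} :
      L.initial S → Forever L.step S T → Behaves L (.diverges T)
  | goeswrong {S S' : L.St} {t : Trace} :
      L.initial S → Star L.step S t S' → (∀ t' S'', ¬ L.step S' t' S'') →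
      (∀ n, ¬ L.final S' n) → Behaves L (.goeswrong t)

/-! ### Machine-specific operators, conditions and addressing modes (PowerPC) -/

inductive Comparison
  | eq
  | ne
  | gt
  | ge
  | lt
  | le

def Comparison.eval (c : Comparison) (x y : ℤ) : Bool :=
  match c with
  | .eq => decide (x = y)
  | .ne => decide (x ≠ y)
  | .gt => decide (x > y)
  | .ge => decide (x ≥ y)
  | .lt => decide (x < y)
  | .le => decide (x ≤ y)

/-- Comparison of pointers to different blocks, or of a pointer and the null pointer. -/
def Comparison.mismatch : Comparison → Option Bool
  | .eq => some false
  | .ne => some true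
  | _ => none

/-- Comparisons of floats: if one of them is a NaN, then only `ne` holds. -/
def Comparison.evalFloat (c : Comparison) (x y : F64) : Bool :=
  if x.isNaN || y.isNaN then (match c with | .ne => true | _ => false) else c.eval x.key y.key

inductive Cond
  /-- signed integer / pointer comparison -/
  | comp (c : Comparison)
  | compimm (c : Comparison) (n : Int32)
  /-- unsigned integer comparison -/
  | compu (c : Comparison)
  | compuimm (c : Comparison) (n : Int32)
  /-- float comparison -/
  | compf (c : Comparison)

inductive Mode
  | indexed (n : Int32)
  | indexed2
  | global (id : Ident) (δ : Int32)
  | based (id : Ident) (δ : Int32)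
  | stack (δ : Int32)

inductive Op
  | move
  | intconst (n : Int32)
  | floatconst (f : F64)
  | addrsymbol (id : Ident) (δ : Int32)
  | addrstack (δ : Int32)
  | cast8s | cast8u | cast16s | cast16u
  | negint | notbool
  | add | addi (n : Int32)
  | sub
  /-- `n` minus the argument -/
  | subi (n : Int32)
  | mul | muli (n : Int32)
  | div | divu
  | and | andi (n : Int32)
  | or | ori (n : Int32)
  | xor | xori (n : Int32)
  | nand | nor | nxor
  | shl | shr | shri (n : Int32) | shru
  /-- signed division by `2 ^ n`, rounding towards zero -/
  | shrxi (n : Int32)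
  /-- rotation to the left by `n` bits, followed by a logical "and" with `m` -/
  | rolm (n m : Int32)
  | negf | absf | addf | subf | mulf | divf
  /-- product of the first two arguments, plus or minus the third -/
  | muladdf | mulsubf
  | singleoffloat | intoffloat | intuoffloat | floatofint | floatofintu
  /-- truth value of a condition; this covers all comparison operators -/
  | cmp (c : Cond)

def evalCond : Cond → List Val → Option Bool
  | .comp c, [.int n₁, .int n₂] => some (c.eval n₁.toInt n₂.toInt)
  | .comp c, [.ptr b₁ δ₁, .ptr b₂ δ₂] =>
      if b₁ = b₂ then some (c.eval δ₁.toInt δ₂.toInt) else c.mismatch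
  | .comp c, [.ptr _ _, .int n] => if n = 0 then c.mismatch else none
  | .comp c, [.int n, .ptr _ _] => if n = 0 then c.mismatch else none
  | .compimm c n, [.int n₁] => some (c.eval n₁.toInt n.toInt)
  | .compimm c n, [.ptr _ _] => if n = 0 then c.mismatch else none
  | .compu c, [.int n₁, .int n₂] => some (c.eval n₁.toNat n₂.toNat)
  | .compuimm c n, [.int n₁] => some (c.eval n₁.toNat n.toNat)
  | .compf c, [.float f₁, .float f₂] => some (c.evalFloat f₁ f₂)
  | _, _ => none

section Eval

variable {Fn : Type} (G : Genv Fn) (σ : Block)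

def evalMode : Mode → List Val → Option Val
  | .indexed n, [.ptr b δ] => some (.ptr b (δ + n))
  | .indexed2, [.ptr b δ, .int n] => some (.ptr b (δ + n))
  | .indexed2, [.int n, .ptr b δ] => some (.ptr b (δ + n))
  | .global id δ, [] => (G.symbol id).map fun b => .ptr b δ
  | .based id δ, [.int n] => (G.symbol id).map fun b => .ptr b (δ + n)
  | .stack δ, [] => some (.ptr σ δ)
  | _, _ => none

def evalOp : Op → List Val → Option Val
  | .move, [v] => some v
  | .intconst n, [] => some (.int n)
  | .floatconst f, [] => some (.float f)
  | .addrsymbol id δ, [] => (G.symbol id).map fun b => .ptr b δ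
  | .addrstack δ, [] => some (.ptr σ δ)
  | .cast8s, [.int n] => some (.int ((n.setWidth 8).signExtend 32))
  | .cast8u, [.int n] => some (.int ((n.setWidth 8).setWidth 32))
  | .cast16s, [.int n] => some (.int ((n.setWidth 16).signExtend 32))
  | .cast16u, [.int n] => some (.int ((n.setWidth 16).setWidth 32))
  | .negint, [.int n] => some (.int (-n))
  | .notbool, [.int n] => some (.ofBool (n == 0))
  | .notbool, [.ptr _ _] => some (.ofBool false)
  | .add, [.int n₁, .int n₂] => some (.int (n₁ + n₂))
  | .add, [.ptr b δ, .int n] => some (.ptr b (δ + n))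
  | .add, [.int n, .ptr b δ] => some (.ptr b (δ + n))
  | .addi n, [.int n₁] => some (.int (n₁ + n))
  | .addi n, [.ptr b δ] => some (.ptr b (δ + n))
  | .sub, [.int n₁, .int n₂] => some (.int (n₁ - n₂))
  | .sub, [.ptr b δ, .int n] => some (.ptr b (δ - n))
  | .sub, [.ptr b₁ δ₁, .ptr b₂ δ₂] => if b₁ = b₂ then some (.int (δ₁ - δ₂)) else none
  | .subi n, [.int n₁] => some (.int (n - n₁))
  | .mul, [.int n₁, .int n₂] => some (.int (n₁ * n₂))
  | .muli n, [.int n₁] => some (.int (n₁ * n))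
  | .div, [.int n₁, .int n₂] => if n₂ = 0 then none else some (.int (n₁.sdiv n₂))
  | .divu, [.int n₁, .int n₂] => if n₂ = 0 then none else some (.int (n₁.udiv n₂))
  | .and, [.int n₁, .int n₂] => some (.int (n₁ &&& n₂))
  | .andi n, [.int n₁] => some (.int (n₁ &&& n))
  | .or, [.int n₁, .int n₂] => some (.int (n₁ ||| n₂))
  | .ori n, [.int n₁] => some (.int (n₁ ||| n))
  | .xor, [.int n₁, .int n₂] => some (.int (n₁ ^^^ n₂))
  | .xori n, [.int n₁] => some (.int (n₁ ^^^ n))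
  | .nand, [.int n₁, .int n₂] => some (.int (~~~(n₁ &&& n₂)))
  | .nor, [.int n₁, .int n₂] => some (.int (~~~(n₁ ||| n₂)))
  | .nxor, [.int n₁, .int n₂] => some (.int (~~~(n₁ ^^^ n₂)))
  | .shl, [.int n₁, .int n₂] =>
      if n₂.toNat < 32 then some (.int (n₁ <<< n₂.toNat)) else none
  | .shr, [.int n₁, .int n₂] =>
      if n₂.toNat < 32 then some (.int (n₁.sshiftRight n₂.toNat)) else none
  | .shri n, [.int n₁] =>
      if n.toNat < 32 then some (.int (n₁.sshiftRight n.toNat)) else none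
  | .shru, [.int n₁, .int n₂] =>
      if n₂.toNat < 32 then some (.int (n₁ >>> n₂.toNat)) else none
  | .shrxi n, [.int n₁] =>
      if n.toNat < 31 then some (.int (n₁.sdiv ((1 : Int32) <<< n.toNat))) else none
  | .rolm n m, [.int n₁] => some (.int (n₁.rotateLeft n.toNat &&& m))
  | .negf, [.float f] => some (.float f.neg)
  | .absf, [.float f] => some (.float f.abs)
  | .addf, [.float f₁, .float f₂] => some (.float (f₁.add f₂))
  | .subf, [.float f₁, .float f₂] => some (.float (f₁.sub f₂))
  | .mulf, [.float f₁, .float f₂] => some (.float (f₁.mul f₂))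
  | .divf, [.float f₁, .float f₂] => some (.float (f₁.div f₂))
  | .muladdf, [.float f₁, .float f₂, .float f₃] => some (.float ((f₁.mul f₂).add f₃))
  | .mulsubf, [.float f₁, .float f₂, .float f₃] => some (.float ((f₁.mul f₂).sub f₃))
  | .singleoffloat, [.float f] => some (.float f.single)
  | .intoffloat, [.float f] => f.toInt32?.map .int
  | .intuoffloat, [.float f] => f.toUInt32?.map .int
  | .floatofint, [.int n] => some (.float (F64.ofRat false n.toInt))
  | .floatofintu, [.int n] => some (.float (F64.ofRat false n.toNat))
  | .cmp c, vs => (evalCond c vs).map .ofBool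
  | _, _ => none

end Eval

def Fundef.sig {Fn : Type} (s : Fn → Signature) : Fundef Fn → Signature
  | .internal f => s f
  | .external fe => fe.sig

/-! ### The source language CminorSel -/

namespace CminorSel

mutual

inductive Expr
  | var (id : Ident)
  | op (o : Op) (as : ExprList)
  | load (κ : Chunk) (m : Mode) (as : ExprList)
  | cond (c : CondExpr) (a₁ a₂ : Expr)

inductive CondExpr
  | tt
  | ff
  | cond (c : Cond) (as : ExprList)
  | ite (c₁ c₂ c₃ : CondExpr)

inductive ExprList
  | nil
  | cons (a : Expr) (as : ExprList)

end

/-- Switch tables. -/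
inductive Table
  | dflt (n : ℕ)
  | case (i : Int32) (n : ℕ) (tbl : Table)

inductive Stmt
  | skip
  | assign (id : Ident) (a : Expr)
  | store (κ : Chunk) (m : Mode) (as : ExprList) (a : Expr)
  | call (id : Option Ident) (a : Expr) (as : ExprList) (sig : Signature)
  | tailcall (a : Expr) (as : ExprList) (sig : Signature)
  | ret (a : Option Expr)
  | seq (s₁ s₂ : Stmt)
  | ifte (c : CondExpr) (s₁ s₂ : Stmt)
  | loop (s : Stmt)
  | block (s : Stmt)
  | exit (n : ℕ)
  | switch (a : Expr) (tbl : Table)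
  | label (lbl : Label) (s : Stmt)
  | goto (lbl : Label)

structure Function where
  sig : Signature
  params : List Ident
  vars : List Ident
  stacksize : ℕ
  body : Stmt

abbrev Program := Compcert.Program Function

/-- Local environments. -/
abbrev Env := Ident → Option Val

/-- Continuations; `halt` is the initial continuation. -/
inductive Cont
  | halt
  | seq (s : Stmt) (k : Cont)
  | endblock (k : Cont)
  | returnto (id : Option Ident) (F : Function) (σ : Block) (E : Env) (k : Cont)

inductive State
  | regular (F : Function) (s : Stmt) (k : Cont) (σ : Block) (E : Env) (M : Mem)
  | call (Fd : Fundef Function) (vs : List Val) (k : Cont) (M : Mem)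
  | ret (v : Val) (k : Cont) (M : Mem)

section Evaluation

variable (G : Genv Function) (σ : Block) (E : Env) (M : Mem)

mutual

inductive EvalExpr : Expr → Val → Prop
  | var {id : Ident} {v : Val} : E id = some v → EvalExpr (.var id) v
  | op {o : Op} {as : ExprList} {vs : List Val} {v : Val} :
      EvalExprList as vs → evalOp G σ o vs = some v → EvalExpr (.op o as) v
  | load {κ : Chunk} {m : Mode} {as : ExprList} {vs : List Val} {b : Block} {δ : Int32} {v : Val} :
      EvalExprList as vs → evalMode G σ m vs = some (.ptr b δ) →
      M.load κ b δ.toInt = some v → EvalExpr (.load κ m as) v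
  | cond_true {c : CondExpr} {a₁ a₂ : Expr} {v : Val} :
      EvalCond c true → EvalExpr a₁ v → EvalExpr (.cond c a₁ a₂) v
  | cond_false {c : CondExpr} {a₁ a₂ : Expr} {v : Val} :
      EvalCond c false → EvalExpr a₂ v → EvalExpr (.cond c a₁ a₂) v

inductive EvalCond : CondExpr → Bool → Prop
  | tt : EvalCond .tt true
  | ff : EvalCond .ff false
  | cond {c : Cond} {as : ExprList} {vs : List Val} {b : Bool} :
      EvalExprList as vs → evalCond c vs = some b → EvalCond (.cond c as) b
  | ite_true {c₁ c₂ c₃ : CondExpr} {b : Bool} :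
      EvalCond c₁ true → EvalCond c₂ b → EvalCond (.ite c₁ c₂ c₃) b
  | ite_false {c₁ c₂ c₃ : CondExpr} {b : Bool} :
      EvalCond c₁ false → EvalCond c₃ b → EvalCond (.ite c₁ c₂ c₃) b

inductive EvalExprList : ExprList → List Val → Prop
  | nil : EvalExprList .nil []
  | cons {a : Expr} {as : ExprList} {v : Val} {vs : List Val} :
      EvalExpr a v → EvalExprList as vs → EvalExprList (.cons a as) (v :: vs)

end

end Evaluation

/-- The exit number that a switch table associates with an integer. -/
def Table.target : Table → Int32 → ℕ
  | .dflt n, _ => n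
  | .case i n tbl, x => if x = i then n else tbl.target x

/-- `[params ← vs]`; a missing argument is `undef`, and excess arguments are ignored. -/
def setParams : List Ident → List Val → Env
  | [], _ => fun _ => none
  | x :: xs, [] => Function.update (setParams xs []) x (some .undef)
  | x :: xs, v :: vs => Function.update (setParams xs vs) x (some v)

/-- `[params ← vs; vars ← undef]`. -/
def initEnv (params vars : List Ident) (vs : List Val) : Env := fun x =>
  if x ∈ vars then some .undef else setParams params vs x

def setOpt (E : Env) (id : Option Ident) (v : Val) : Env :=
  match id with
  | some x => Function.update E x (some v)
  | none => E

/-- `halt` and `returnto` continuations. -/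
def Cont.IsCall : Cont → Prop
  | .halt => True
  | .returnto _ _ _ _ _ => True
  | _ => False

def callcont : Cont → Cont
  | .seq _ k => callcont k
  | .endblock k => callcont k
  | k => k

def findlabel (lbl : Label) : Stmt → Cont → Option (Stmt × Cont)
  | .seq s₁ s₂, k =>
      match findlabel lbl s₁ (.seq s₂ k) with
      | some r => some r
      | none => findlabel lbl s₂ k
  | .ifte _ s₁ s₂, k =>
      match findlabel lbl s₁ k with
      | some r => some r
      | none => findlabel lbl s₂ k
  | .loop s, k => findlabel lbl s (.seq (.loop s) k)
  | .block s, k => findlabel lbl s (.endblock k)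
  | .label lbl' s, k => if lbl' = lbl then some (s, k) else findlabel lbl s k
  | _, _ => none

inductive Step (G : Genv Function) : State → Trace → State → Prop
  | skip_seq {F s k σ E M} :
      Step G (.regular F .skip (.seq s k) σ E M) [] (.regular F s k σ E M)
  | skip_endblock {F k σ E M} :
      Step G (.regular F .skip (.endblock k) σ E M) [] (.regular F .skip k σ E M)
  | assign {F id a k σ E M v} :
      EvalExpr G σ E M a v →
      Step G (.regular F (.assign id a) k σ E M) []
        (.regular F .skip k σ (Function.update E id (some v)) M)
  | store {F κ m as a k σ E M vs b δ v M'} :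
      EvalExprList G σ E M as vs → evalMode G σ m vs = some (.ptr b δ) →
      EvalExpr G σ E M a v → M.store κ b δ.toInt v = some M' →
      Step G (.regular F (.store κ m as a) k σ E M) [] (.regular F .skip k σ E M')
  | seq {F s₁ s₂ k σ E M} :
      Step G (.regular F (.seq s₁ s₂) k σ E M) [] (.regular F s₁ (.seq s₂ k) σ E M)
  | if_true {F c s₁ s₂ k σ E M} :
      EvalCond G σ E M c true →
      Step G (.regular F (.ifte c s₁ s₂) k σ E M) [] (.regular F s₁ k σ E M)
  | if_false {F c s₁ s₂ k σ E M} :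
      EvalCond G σ E M c false →
      Step G (.regular F (.ifte c s₁ s₂) k σ E M) [] (.regular F s₂ k σ E M)
  | loop {F s k σ E M} :
      Step G (.regular F (.loop s) k σ E M) [] (.regular F s (.seq (.loop s) k) σ E M)
  | block {F s k σ E M} :
      Step G (.regular F (.block s) k σ E M) [] (.regular F s (.endblock k) σ E M)
  | exit_seq {F n s k σ E M} :
      Step G (.regular F (.exit n) (.seq s k) σ E M) [] (.regular F (.exit n) k σ E M)
  | exit_zero {F k σ E M} :
      Step G (.regular F (.exit 0) (.endblock k) σ E M) [] (.regular F .skip k σ E M)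
  | exit_succ {F n k σ E M} :
      Step G (.regular F (.exit (n + 1)) (.endblock k) σ E M) [] (.regular F (.exit n) k σ E M)
  | switch {F a tbl k σ E M n} :
      EvalExpr G σ E M a (.int n) →
      Step G (.regular F (.switch a tbl) k σ E M) [] (.regular F (.exit (tbl.target n)) k σ E M)
  | label {F lbl s k σ E M} :
      Step G (.regular F (.label lbl s) k σ E M) [] (.regular F s k σ E M)
  | goto {F lbl k σ E M s' k'} :
      findlabel lbl F.body (callcont k) = some (s', k') →
      Step G (.regular F (.goto lbl) k σ E M) [] (.regular F s' k' σ E M)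
  | call {F id a as sig k σ E M b vs Fd} :
      EvalExpr G σ E M a (.ptr b 0) → EvalExprList G σ E M as vs →
      G.funct b = some Fd → Fd.sig Function.sig = sig →
      Step G (.regular F (.call id a as sig) k σ E M) []
        (.call Fd vs (.returnto id F σ E k) M)
  | tailcall {F a as sig k σ E M b vs Fd} :
      EvalExpr G σ E M a (.ptr b 0) → EvalExprList G σ E M as vs →
      G.funct b = some Fd → Fd.sig Function.sig = sig →
      Step G (.regular F (.tailcall a as sig) k σ E M) []
        (.call Fd vs (callcont k) (M.free σ))
  | skip_return {F k σ E M} :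
      F.sig.res = none → k.IsCall →
      Step G (.regular F .skip k σ E M) [] (.ret .undef k (M.free σ))
  | return_none {F k σ E M} :
      F.sig.res = none →
      Step G (.regular F (.ret none) k σ E M) [] (.ret .undef (callcont k) (M.free σ))
  | return_some {F a k σ E M v} :
      F.sig.res ≠ none → EvalExpr G σ E M a v →
      Step G (.regular F (.ret (some a)) k σ E M) [] (.ret v (callcont k) (M.free σ))
  | internal {F vs k M σ M'} :
      M.alloc 0 F.stacksize = (σ, M') →
      Step G (.call (.internal F) vs k M) []
        (.regular F F.body k σ (initEnv F.params F.vars vs) M')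
  | external {fe vs k M t v} :
      ExtCall fe vs t v →
      Step G (.call (.external fe) vs k M) t (.ret v k M)
  | ret {v id F σ E k M} :
      Step G (.ret v (.returnto id F σ E k) M) [] (.regular F .skip k σ (setOpt E id v) M)

inductive Initial (P : Program) : State → Prop
  | mk {b : Block} {Fd : Fundef Function} :
      (globalenv P).symbol P.main = some b → (globalenv P).funct b = some Fd →
      Initial P (.call Fd [] .halt (initmem P))

inductive Final : State → Int32 → Prop
  | mk {n : Int32} {M : Mem} : Final (.ret (.int n) .halt M) n

def semantics (P : Program) : Semantics where
  St := State
  step := Step (globalenv P)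
  initial := Initial P
  final := Final

/-! Number of nodes of abstract syntax trees, and the measure on states. -/

mutual

def Expr.size : Expr → ℕ
  | .var _ => 1
  | .op _ as => 1 + as.size
  | .load _ _ as => 1 + as.size
  | .cond c a₁ a₂ => 1 + c.size + a₁.size + a₂.size

def CondExpr.size : CondExpr → ℕ
  | .tt => 1
  | .ff => 1
  | .cond _ as => 1 + as.size
  | .ite c₁ c₂ c₃ => 1 + c₁.size + c₂.size + c₃.size

/-- The total number of nodes of the members of the list. -/
def ExprList.size : ExprList → ℕ
  | .nil => 0
  | .cons a as => a.size + as.size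

end

def Table.size : Table → ℕ
  | .dflt _ => 1
  | .case _ _ tbl => 1 + tbl.size

def Stmt.size : Stmt → ℕ
  | .skip => 1
  | .assign _ a => 1 + a.size
  | .store _ _ as a => 1 + as.size + a.size
  | .call _ a as _ => 1 + a.size + as.size
  | .tailcall a as _ => 1 + a.size + as.size
  | .ret none => 1
  | .ret (some a) => 1 + a.size
  | .seq s₁ s₂ => 1 + s₁.size + s₂.size
  | .ifte c s₁ s₂ => 1 + c.size + s₁.size + s₂.size
  | .loop s => 1 + s.size
  | .block s => 1 + s.size
  | .exit _ => 1
  | .switch a tbl => 1 + a.size + tbl.size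
  | .label _ s => 1 + s.size
  | .goto _ => 1

def Cont.size : Cont → ℕ
  | .seq s k => 1 + s.size + k.size
  | .endblock k => 1 + k.size
  | _ => 0

/-- The measure, in `ℕ × ℕ` with the lexicographic order. -/
def State.measure : State → ℕ ×ₗ ℕ
  | .regular _ s k _ _ _ => toLex (s.size + k.size, s.size)
  | _ => toLex (0, 0)

end CminorSel

/-! ### The target language RTL -/

namespace RTL

/-- Pseudo-registers. -/
abbrev Reg := ℕ
/-- Labels of the nodes of control-flow graphs. -/
abbrev Node := ℕ

/-- The function to be called: the contents of a register, or a global symbol. -/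
inductive Callee
  | reg (r : Reg)
  | symbol (id : Ident)

inductive Instr
  | nop (l : Node)
  | op (o : Op) (rs : List Reg) (r : Reg) (l : Node)
  | load (κ : Chunk) (m : Mode) (rs : List Reg) (r : Reg) (l : Node)
  | store (κ : Chunk) (m : Mode) (rs : List Reg) (r : Reg) (l : Node)
  | call (sig : Signature) (f : Callee) (rs : List Reg) (r : Reg) (l : Node)
  | tailcall (sig : Signature) (f : Callee) (rs : List Reg)
  | cond (c : Cond) (rs : List Reg) (ltrue lfalse : Node)
  | ret (r : Option Reg)

/-- Control-flow graphs: finite maps from nodes to instructions. -/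
abbrev Cfg := Finmap fun _ : Node => Instr

structure Function where
  sig : Signature
  params : List Reg
  stacksize : ℕ
  entrypoint : Node
  code : Cfg

abbrev Program := Compcert.Program Function

abbrev RegState := Reg → Val

structure Frame where
  r : Reg
  g : Cfg
  σ : Block
  l : Node
  R : RegState

inductive State
  | regular (stk : List Frame) (g : Cfg) (σ : Block) (l : Node) (R : RegState) (M : Mem)
  | call (stk : List Frame) (Fd : Fundef Function) (vs : List Val) (M : Mem)
  | ret (stk : List Frame) (v : Val) (M : Mem)

/-- `[params ↦ vs]`; all other registers are `undef`. -/
def initRegs : List Reg → List Val → RegState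
  | r :: rs, v :: vs => Function.update (initRegs rs vs) r v
  | _, _ => fun _ => .undef

/-- The block of the function designated in a call instruction. -/
inductive CalleeBlock (G : Genv Function) (R : RegState) : Callee → Block → Prop
  | reg {r : Reg} {b : Block} : R r = .ptr b 0 → CalleeBlock G R (.reg r) b
  | symbol {id : Ident} {b : Block} : G.symbol id = some b → CalleeBlock G R (.symbol id) b

inductive Step (G : Genv Function) : State → Trace → State → Prop
  | nop {stk g σ l R M l'} :
      g.lookup l = some (.nop l') →
      Step G (.regular stk g σ l R M) [] (.regular stk g σ l' R M)
  | op {stk g σ l R M o rs r l' v} :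
      g.lookup l = some (.op o rs r l') → evalOp G σ o (rs.map R) = some v →
      Step G (.regular stk g σ l R M) [] (.regular stk g σ l' (Function.update R r v) M)
  | load {stk g σ l R M κ m rs r l' b δ v} :
      g.lookup l = some (.load κ m rs r l') →
      evalMode G σ m (rs.map R) = some (.ptr b δ) → M.load κ b δ.toInt = some v →
      Step G (.regular stk g σ l R M) [] (.regular stk g σ l' (Function.update R r v) M)
  | store {stk g σ l R M κ m rs r l' b δ M'} :
      g.lookup l = some (.store κ m rs r l') →
      evalMode G σ m (rs.map R) = some (.ptr b δ) → M.store κ b δ.toInt (R r) = some M' →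
      Step G (.regular stk g σ l R M) [] (.regular stk g σ l' R M')
  | call {stk g σ l R M sig f rs r l' b Fd} :
      g.lookup l = some (.call sig f rs r l') →
      CalleeBlock G R f b → G.funct b = some Fd → Fd.sig Function.sig = sig →
      Step G (.regular stk g σ l R M) [] (.call (⟨r, g, σ, l', R⟩ :: stk) Fd (rs.map R) M)
  | tailcall {stk g σ l R M sig f rs b Fd} :
      g.lookup l = some (.tailcall sig f rs) →
      CalleeBlock G R f b → G.funct b = some Fd → Fd.sig Function.sig = sig →
      Step G (.regular stk g σ l R M) [] (.call stk Fd (rs.map R) (M.free σ))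
  | cond_true {stk g σ l R M c rs ltrue lfalse} :
      g.lookup l = some (.cond c rs ltrue lfalse) → evalCond c (rs.map R) = some true →
      Step G (.regular stk g σ l R M) [] (.regular stk g σ ltrue R M)
  | cond_false {stk g σ l R M c rs ltrue lfalse} :
      g.lookup l = some (.cond c rs ltrue lfalse) → evalCond c (rs.map R) = some false →
      Step G (.regular stk g σ l R M) [] (.regular stk g σ lfalse R M)
  | return_none {stk g σ l R M} :
      g.lookup l = some (.ret none) →
      Step G (.regular stk g σ l R M) [] (.ret stk .undef (M.free σ))
  | return_some {stk g σ l R M r} :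
      g.lookup l = some (.ret (some r)) →
      Step G (.regular stk g σ l R M) [] (.ret stk (R r) (M.free σ))
  | internal {stk F vs M σ M'} :
      M.alloc 0 (Function.stacksize F) = (σ, M') →
      Step G (.call stk (.internal F) vs M) []
        (.regular stk F.code σ F.entrypoint (initRegs F.params vs) M')
  | external {stk fe vs M t v} :
      ExtCall fe vs t v →
      Step G (.call stk (.external fe) vs M) t (.ret stk v M)
  | ret {r g σ l R stk v M} :
      Step G (.ret (⟨r, g, σ, l, R⟩ :: stk) v M) []
        (.regular stk g σ l (Function.update R r v) M)

inductive Initial (P : Program) : State → Prop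
  | mk {b : Block} {Fd : Fundef Function} :
      (globalenv P).symbol P.main = some b → (globalenv P).funct b = some Fd →
      Initial P (.call [] Fd [] (initmem P))

inductive Final : State → Int32 → Prop
  | mk {n : Int32} {M : Mem} : Final (.ret [] (.int n) M) n

def semantics (P : Program) : Semantics where
  St := State
  step := Step (globalenv P)
  initial := Initial P
  final := Final

end RTL

/-! ### Relational specification of the translation from CminorSel to RTL -/

namespace RTLgen

open CminorSel RTL

/-- Maps `γ` from source variables to the registers that hold their values. -/
abbrev VarMap := Ident → Option Reg
/-- Maps from source labels to nodes. -/
abbrev LabelMap := Label → Option Node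

def VarMap.Injective (γ : VarMap) : Prop :=
  ∀ x y r, γ x = some r → γ y = some r → x = y

def VarMap.range (γ : VarMap) : Set Reg := {r | ∃ x, γ x = some r}

section Spec

variable (g : Cfg) (γ : VarMap)

mutual

/-- `TrExpr g γ π a rd l₁ l₂`: the sub-graph of `g` from `l₁` to `l₂` computes `a` in `rd` and
preserves the registers in `π` and in the range of `γ`. -/
inductive TrExpr : Set Reg → Expr → Reg → Node → Node → Prop
  | var {π id rd l₁} : γ id = some rd → TrExpr π (.var id) rd l₁ l₁
  | var_move {π id r rd l₁ l₂} :
      γ id = some r → g.lookup l₁ = some (.op .move [r] rd l₂) → rd ∉ VarMap.range γ ∪ π →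
      TrExpr π (.var id) rd l₁ l₂
  | op {π o as rs rd l₁ l l₂} :
      TrExprList π as rs l₁ l → g.lookup l = some (.op o rs rd l₂) → rd ∉ VarMap.range γ ∪ π →
      TrExpr π (.op o as) rd l₁ l₂
  | load {π κ m as rs rd l₁ l l₂} :
      TrExprList π as rs l₁ l → g.lookup l = some (.load κ m rs rd l₂) →
      rd ∉ VarMap.range γ ∪ π →
      TrExpr π (.load κ m as) rd l₁ l₂
  | cond {π c a₁ a₂ rd l₁ ltrue lfalse l₂} :
      TrCond π c l₁ ltrue lfalse → TrExpr π a₁ rd ltrue l₂ → TrExpr π a₂ rd lfalse l₂ →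
      TrExpr π (.cond c a₁ a₂) rd l₁ l₂

/-- The sub-graph that starts at `l₁` leads to `ltrue` or to `lfalse`, according to the value of
the condition. -/
inductive TrCond : Set Reg → CondExpr → Node → Node → Node → Prop
  | tt {π ltrue lfalse} : TrCond π .tt ltrue ltrue lfalse
  | ff {π ltrue lfalse} : TrCond π .ff lfalse ltrue lfalse
  | cond {π c as rs l₁ l ltrue lfalse} :
      TrExprList π as rs l₁ l → g.lookup l = some (.cond c rs ltrue lfalse) →
      TrCond π (.cond c as) l₁ ltrue lfalse
  | ite {π c₁ c₂ c₃ l₁ l₂ l₃ ltrue lfalse} :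
      TrCond π c₁ l₁ l₂ l₃ → TrCond π c₂ l₂ ltrue lfalse → TrCond π c₃ l₃ ltrue lfalse →
      TrCond π (.ite c₁ c₂ c₃) l₁ ltrue lfalse

inductive TrExprList : Set Reg → ExprList → List Reg → Node → Node → Prop
  | nil {π l₁} : TrExprList π .nil [] l₁ l₁
  | cons {π a as r rs l₁ l l₂} :
      TrExpr π a r l₁ l → TrExprList (π ∪ {r}) as rs l l₂ → r ∉ VarMap.range γ ∪ π →
      TrExprList π (.cons a as) (r :: rs) l₁ l₂

end

/-- The code between `l` and `l₂` that follows a call with destination register `r` and puts the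
result in the register of the variable `id`, if any. -/
inductive TrResult : Reg → Option Ident → Node → Node → Prop
  | unused {r l₂} : r ∉ VarMap.range γ → TrResult r none l₂ l₂
  | direct {r id l₂} : γ id = some r → TrResult r (some id) l₂ l₂
  | move {r id r' l l₂} :
      r ∉ VarMap.range γ → γ id = some r' → g.lookup l = some (.op .move [r] r' l₂) →
      TrResult r (some id) l l₂

/-- Decision trees for `switch` statements. -/
inductive DecTree
  | action (n : ℕ)
  | ifeq (i : Int32) (n : ℕ) (t : DecTree)
  | iflt (i : Int32) (t₁ t₂ : DecTree)

/-- The exit number that a decision tree selects for an integer. -/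
def DecTree.target : DecTree → Int32 → ℕ
  | .action n, _ => n
  | .ifeq i n t, x => if x = i then n else t.target x
  | .iflt i t₁ t₂, x => if x.toNat < i.toNat then t₁.target x else t₂.target x

/-- The sub-graph that starts at `l` branches on the integer in `r` according to a tree. -/
inductive TrTree (r : Reg) (le : List Node) : DecTree → Node → Prop
  | action {n l} : le[n]? = some l → TrTree r le (.action n) l
  | ifeq {i n t l lfound lnext} :
      g.lookup l = some (.cond (.compimm .eq i) [r] lfound lnext) →
      le[n]? = some lfound → TrTree r le t lnext →
      TrTree r le (.ifeq i n t) l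
  | iflt {i t₁ t₂ l l₁ l₂} :
      g.lookup l = some (.cond (.compuimm .lt i) [r] l₁ l₂) →
      TrTree r le t₁ l₁ → TrTree r le t₂ l₂ →
      TrTree r le (.iflt i t₁ t₂) l

/-- `TrStmt g γ lg lr rr s l₁ l₂ le`: the sub-graph of `g` that starts at `l₁` performs `s`, and
branches to `l₂` on normal termination, to `le[n]` on `exit n`, to `lg lbl` on `goto lbl`, and to
`lr`, with the value in `rr` if any, on `return`. -/
inductive TrStmt (lg : LabelMap) (lr : Node) (rr : Option Reg) :
    Stmt → Node → Node → List Node → Prop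
  | skip {l₁ le} : TrStmt lg lr rr .skip l₁ l₁ le
  | assign {id a rd l₁ l₂ le} :
      γ id = some rd → TrExpr g γ ∅ a rd l₁ l₂ →
      TrStmt lg lr rr (.assign id a) l₁ l₂ le
  | assign_move {id a r rd l₁ l l₂ le} :
      γ id = some r → TrExpr g γ ∅ a rd l₁ l → g.lookup l = some (.op .move [rd] r l₂) →
      TrStmt lg lr rr (.assign id a) l₁ l₂ le
  | store {κ m as a rs r l₁ l l' l₂ le} :
      TrExprList g γ ∅ as rs l₁ l → TrExpr g γ {x | x ∈ rs} a r l l' →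
      g.lookup l' = some (.store κ m rs r l₂) →
      TrStmt lg lr rr (.store κ m as a) l₁ l₂ le
  | call {id a as sig rf rs r l₁ l l' l'' l₂ le} :
      TrExpr g γ ∅ a rf l₁ l → TrExprList g γ {rf} as rs l l' →
      g.lookup l' = some (.call sig (.reg rf) rs r l'') → TrResult g γ r id l'' l₂ →
      TrStmt lg lr rr (.call id a as sig) l₁ l₂ le
  | tailcall {a as sig rf rs l₁ l l' l₂ le} :
      TrExpr g γ ∅ a rf l₁ l → TrExprList g γ {rf} as rs l l' →
      g.lookup l' = some (.tailcall sig (.reg rf) rs) →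
      TrStmt lg lr rr (.tailcall a as sig) l₁ l₂ le
  | return_none {l₂ le} : TrStmt lg lr rr (.ret none) lr l₂ le
  | return_some {a r l₁ l₂ le} :
      rr = some r → TrExpr g γ ∅ a r l₁ lr →
      TrStmt lg lr rr (.ret (some a)) l₁ l₂ le
  | seq {s₁ s₂ l₁ l l₂ le} :
      TrStmt lg lr rr s₁ l₁ l le → TrStmt lg lr rr s₂ l l₂ le →
      TrStmt lg lr rr (.seq s₁ s₂) l₁ l₂ le
  | ifte {c s₁ s₂ l₁ ltrue lfalse l₂ le} :
      TrCond g γ ∅ c l₁ ltrue lfalse →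
      TrStmt lg lr rr s₁ ltrue l₂ le → TrStmt lg lr rr s₂ lfalse l₂ le →
      TrStmt lg lr rr (.ifte c s₁ s₂) l₁ l₂ le
  | loop {s l₁ l l₂ le} :
      g.lookup l₁ = some (.nop l) → TrStmt lg lr rr s l l₁ le →
      TrStmt lg lr rr (.loop s) l₁ l₂ le
  | block {s l₁ l₂ le} :
      TrStmt lg lr rr s l₁ l₂ (l₂ :: le) →
      TrStmt lg lr rr (.block s) l₁ l₂ le
  | exit {n l₁ l₂ le} :
      le[n]? = some l₁ →
      TrStmt lg lr rr (.exit n) l₁ l₂ le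
  | switch {a tbl t r l₁ l l₂ le} :
      (∀ x, t.target x = tbl.target x) → TrExpr g γ ∅ a r l₁ l → TrTree g r le t l →
      TrStmt lg lr rr (.switch a tbl) l₁ l₂ le
  | label {lbl s l l₁ l₂ le} :
      lg lbl = some l → g.lookup l = some (.nop l₁) → TrStmt lg lr rr s l₁ l₂ le →
      TrStmt lg lr rr (.label lbl s) l₁ l₂ le
  | goto {lbl l₁ l₂ le} :
      lg lbl = some l₁ →
      TrStmt lg lr rr (.goto lbl) l₁ l₂ le

/-- The body of `F` is translated to the sub-graph of `g` that starts at `l₁` and ends at a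
`return` instruction appropriate to the signature of `F`. -/
structure TrBody (lg : LabelMap) (lr : Node) (rr : Option Reg)
    (F : CminorSel.Function) (l₁ : Node) : Prop where
  injective : γ.Injective
  body : TrStmt g γ lg lr rr F.body l₁ lr []
  ret : g.lookup lr = some (.ret rr)
  ret_sig : rr.isSome = F.sig.res.isSome

end Spec

/-- `F'` is an acceptable translation of `F`. A parameter `x` is passed in the register `γ x`,
except if it is shadowed by a local variable of the same name: then it is passed in a register
that holds no variable. -/
structure TrFunction (F : CminorSel.Function) (F' : RTL.Function) : Prop where
  sig : F'.sig = F.sig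
  stacksize : F'.stacksize = F.stacksize
  body : ∃ (γ : VarMap) (lg : LabelMap) (lr : Node) (rr : Option Reg),
    TrBody F'.code γ lg lr rr F F'.entrypoint ∧
    (∀ x, (γ x).isSome ↔ x ∈ F.params ∨ x ∈ F.vars) ∧
    List.Forall₂ (fun x r => if x ∈ F.vars then r ∉ VarMap.range γ else γ x = some r)
      F.params F'.params

inductive TrFundef : Fundef CminorSel.Function → Fundef RTL.Function → Prop
  | internal {F F'} : TrFunction F F' → TrFundef (.internal F) (.internal F')
  | external {fe} : TrFundef (.external fe) (.external fe)

/-- `P'` is an acceptable translation of `P`. -/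
structure TrProgram (P : CminorSel.Program) (P' : RTL.Program) : Prop where
  vars : P'.vars = P.vars
  main : P'.main = P.main
  functs : List.Forall₂ (fun p p' => p'.1 = p.1 ∧ TrFundef p.2 p'.2) P.functs P'.functs

/-! ### The simulation relation -/

/-- Agreement of a source environment and a register state. -/
def Agree (γ : VarMap) (E : Env) (R : RegState) : Prop :=
  ∀ x r, γ x = some r → E x = some (R r)

mutual

/-- `TrCont g γ lg lr rr k l₂ le stk`: the local part of the continuation `k` corresponds to paths
of `g` from `l₂` and from the nodes in `le` to the `return` instruction at `lr`, and the rest of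
`k` corresponds to the call stack `stk`. -/
inductive TrCont : Cfg → VarMap → LabelMap → Node → Option Reg →
    Cont → Node → List Node → List Frame → Prop
  | seq {g γ lg lr rr s k l₂ l le stk} :
      TrStmt g γ lg lr rr s l₂ l le → TrCont g γ lg lr rr k l le stk →
      TrCont g γ lg lr rr (.seq s k) l₂ le stk
  | endblock {g γ lg lr rr k l₂ le stk} :
      TrCont g γ lg lr rr k l₂ le stk →
      TrCont g γ lg lr rr (.endblock k) l₂ (l₂ :: le) stk
  | callcont {g γ lg lr rr k stk} :
      g.lookup lr = some (.ret rr) → MatchStack k stk →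
      TrCont g γ lg lr rr k lr [] stk

/-- Correspondence between call continuations (`halt` or `returnto`) and call stacks. -/
inductive MatchStack : Cont → List Frame → Prop
  | halt : MatchStack .halt []
  | returnto {id F σ E k r g l R stk γ lg lr rr l₁ l₂ le} :
      TrBody g γ lg lr rr F l₁ →
      Agree γ E R →
      TrResult g γ r id l l₂ →
      TrCont g γ lg lr rr k l₂ le stk →
      MatchStack (.returnto id F σ E k) (⟨r, g, σ, l, R⟩ :: stk)

end

/-- The relation `∼` between CminorSel states and RTL states. -/
inductive MatchStates : CminorSel.State → RTL.State → Prop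
  | regular {F s k σ E M stk g l₁ R γ lg lr rr l₀ l₂ le} :
      TrBody g γ lg lr rr F l₀ →
      TrStmt g γ lg lr rr s l₁ l₂ le →
      TrCont g γ lg lr rr k l₂ le stk →
      Agree γ E R →
      MatchStates (.regular F s k σ E M) (.regular stk g σ l₁ R M)
  | call {Fd Fd' vs k M stk} :
      TrFundef Fd Fd' → MatchStack k stk →
      MatchStates (.call Fd vs k M) (.call stk Fd' vs M)
  | ret {v k M stk} :
      MatchStack k stk →
      MatchStates (.ret v k M) (.ret stk v M)

end RTLgen

end Compcert

/-!
The proof is a forward simulation. Each step of the source is matched by the code that the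
relational specification associates with the current statement:

* The code for an expression, a condition or an argument list runs silently from its first node to
  its last one, computes the same value, preserves the agreement of the environment with the
  registers, and preserves the protected registers `π` (`trExpr_star`, `trCond_star`,
  `trExprList_star`). Protection is what keeps the registers of the first arguments intact while
  the next ones are computed: every destination of a temporary is outside `π` and the range of `γ`.
* The code for a `goto` is the node of the label, because looking up the label in the source body
  retraces the translation of the body (`findlabel_trStmt`).
* The remaining facts concern the boundaries of functions: parameter passing (`agree_init`), the
  transfer of a result (`trResult_star`), and the part of a continuation that survives a `return`
  (`TrCont.matchStack_callcont`).

Source steps without target code (entering a block, popping a continuation, an assignment of a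
variable to itself, ...) all shrink the measure, so `step_simulation` follows by cases.

For behaviors, finite executions are simulated step by step. For a diverging execution, only
finitely many successive source steps can be matched by no target step, as the measure is well
founded; hence a diverging source state is always related to a target state that can take at least
one step to a target state related to a diverging one (`forever_plus`), which yields an infinite
execution of the target with the same trace.
-/

namespace Compcert

/-! ### Sequences of transitions -/

section Transitions

variable {St : Type} {step : St → Trace → St → Prop}

theorem Star.one {S S' : St} {t : Trace} (h : step S t S') : Star step S t S' := by
  simpa using Star.step h (Star.refl S')

theorem Plus.one {S S' : St} {t : Trace} (h : step S t S') : Plus step S t S' := by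
  simpa using Plus.mk h (Star.refl S')

theorem Star.trans {S S' S'' : St} {t₁ t₂ : Trace} (h₁ : Star step S t₁ S')
    (h₂ : Star step S' t₂ S'') : Star step S (t₁ ++ t₂) S'' := by
  induction h₁ with
  | refl => exact h₂
  | step h _ ih => rw [List.append_assoc]; exact .step h (ih h₂)

theorem Plus.star {S S' : St} {t : Trace} (h : Plus step S t S') : Star step S t S' := by
  cases h with
  | mk h h' => exact .step h h'

theorem Star.silent_trans {S S' S'' : St} {t : Trace} (h₁ : Star step S [] S')
    (h₂ : Star step S' t S'') : Star step S t S'' :=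
  h₁.trans h₂

theorem Star.silent_snoc {S S' S'' : St} {t : Trace} (h₁ : Star step S [] S')
    (h₂ : step S' t S'') : Star step S t S'' :=
  h₁.silent_trans (.one h₂)

theorem Star.trans_plus {S S' S'' : St} {t₁ t₂ : Trace} (h₁ : Star step S t₁ S')
    (h₂ : Plus step S' t₂ S'') : Plus step S (t₁ ++ t₂) S'' := by
  cases h₁ with
  | refl => exact h₂
  | step h h₁ => rw [List.append_assoc]; exact .mk h (h₁.trans h₂.star)

theorem Star.silent_plus {S S' S'' : St} {t : Trace} (h₁ : Star step S [] S')
    (h₂ : step S' t S'') : Plus step S t S'' :=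
  h₁.trans_plus (.one h₂)

theorem Forever.unfold {S : St} {T : InfTrace} (h : Forever step S T) :
    ∃ t S' T', step S t S' ∧ T = Stream'.Seq.append (Stream'.Seq.ofList t) T' ∧
      Forever step S' T' := by
  obtain ⟨X, hX, hstep⟩ := h
  obtain ⟨t, S', T', h₁, h₂, h₃⟩ := hstep S T hX
  exact ⟨t, S', T', h₁, h₂, X, h₃, hstep⟩

end Transitions

theorem ofList_append_append (t₁ t₂ : Trace) (T : InfTrace) :
    Stream'.Seq.append (Stream'.Seq.ofList (t₁ ++ t₂)) T =
      Stream'.Seq.append (Stream'.Seq.ofList t₁) (Stream'.Seq.append (Stream'.Seq.ofList t₂) T) := by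
  rw [Stream'.Seq.ofList_append]
  exact Stream'.Seq.append_assoc _ _ _

/-- Coinduction principle for `Forever` in which one unfolding of the relation `X` consumes a
nonempty sequence of transitions instead of a single one. -/
theorem forever_of_plus {St : Type} {step : St → Trace → St → Prop}
    {X : St → InfTrace → Prop}
    (hX : ∀ S T, X S T → ∃ t S' T', Plus step S t S' ∧
      T = Stream'.Seq.append (Stream'.Seq.ofList t) T' ∧ X S' T')
    {S : St} {T : InfTrace} (h : X S T) : Forever step S T := by
  -- States in the middle of a sequence have to be included in the relation.
  refine ⟨fun S T => ∃ t S' T', Star step S t S' ∧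
    T = Stream'.Seq.append (Stream'.Seq.ofList t) T' ∧ X S' T',
    ⟨[], S, T, .refl S, by simp, h⟩, ?_⟩
  rintro S T ⟨t₁, S₁, T₁, hstar, rfl, h₁⟩
  obtain ⟨t₂, S₂, T₂, hplus, rfl, h₂⟩ := hX S₁ T₁ h₁
  rw [← ofList_append_append]
  generalize t₁ ++ t₂ = t, hstar.trans_plus hplus = hp
  cases hp with
  | mk h h' => exact ⟨_, _, _, h, ofList_append_append _ _ _, _, _, _, h', rfl, h₂⟩

/-! ### Global environments of a program and its translation -/

section Globals

variable {Fn Fn' : Type}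

theorem evalOp_congr {G : Genv Fn} {G' : Genv Fn'} (hG : G'.symbol = G.symbol) (σ : Block) (o : Op)
    (vs : List Val) : evalOp G' σ o vs = evalOp G σ o vs := by
  obtain ⟨s, f⟩ := G
  obtain ⟨s', f'⟩ := G'
  obtain rfl : s' = s := hG
  rfl

theorem evalMode_congr {G : Genv Fn} {G' : Genv Fn'} (hG : G'.symbol = G.symbol) (σ : Block)
    (m : Mode) (vs : List Val) : evalMode G' σ m vs = evalMode G σ m vs := by
  obtain ⟨s, f⟩ := G
  obtain ⟨s', f'⟩ := G'
  obtain rfl : s' = s := hG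
  rfl

theorem findIdx?_fst_congr {α β β' : Type} {r : β → β' → Prop} (q : α → Bool)
    {xs : List (α × β)} {ys : List (α × β')}
    (h : List.Forall₂ (fun x y => y.1 = x.1 ∧ r x.2 y.2) xs ys) :
    ys.findIdx? (fun y => q y.1) = xs.findIdx? (fun x => q x.1) := by
  induction h with
  | nil => rfl
  | cons hxy _ ih => simp only [List.findIdx?_cons, hxy.1, ih]

end Globals

namespace RTLgen

open CminorSel RTL

theorem TrProgram.symbol {P : CminorSel.Program} {P' : RTL.Program} (hP : TrProgram P P') :
    (globalenv P').symbol = (globalenv P).symbol := by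
  funext id
  simp only [globalenv, hP.vars]
  rw [findIdx?_fst_congr (fun x => x == id) hP.functs]

theorem TrProgram.funct {P : CminorSel.Program} {P' : RTL.Program} (hP : TrProgram P P')
    {b : Block} {Fd : Fundef CminorSel.Function} (h : (globalenv P).funct b = some Fd) :
    ∃ Fd', (globalenv P').funct b = some Fd' ∧ TrFundef Fd Fd' := by
  simp only [globalenv] at h ⊢
  split_ifs at h ⊢
  simp only [Option.map_eq_some_iff] at h ⊢
  obtain ⟨p, hp, rfl⟩ := h
  obtain ⟨hlen, hget⟩ := List.forall₂_iff_get.1 hP.functs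
  obtain ⟨hi, rfl⟩ := List.getElem?_eq_some_iff.1 hp
  have hi' := hlen ▸ hi
  exact ⟨_, ⟨_, List.getElem?_eq_getElem hi', rfl⟩, (hget _ hi hi').2⟩

theorem TrProgram.initmem {P : CminorSel.Program} {P' : RTL.Program} (hP : TrProgram P P') :
    initmem P' = initmem P := by
  simp only [Compcert.initmem, hP.vars]

theorem TrFundef.sig {Fd : Fundef CminorSel.Function} {Fd' : Fundef RTL.Function}
    (h : TrFundef Fd Fd') : Fd'.sig RTL.Function.sig = Fd.sig CminorSel.Function.sig := by
  cases h with
  | internal h => exact h.sig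
  | external => rfl

/-! ### Agreement of environments and registers -/

theorem Agree.update_temp {γ : VarMap} {E : Env} {R : RegState} (h : Agree γ E R) {r : Reg}
    (hr : r ∉ γ.range) (v : Val) : Agree γ E (Function.update R r v) := by
  intro x r' hx
  have hne : r' ≠ r := by rintro rfl; exact hr ⟨x, hx⟩
  rw [Function.update_of_ne hne]
  exact h x r' hx

/-- Assignment to the variable `x` when its register already holds the new value in `R'`. -/
theorem Agree.update_var {γ : VarMap} {E : Env} {R R' : RegState} (h : Agree γ E R) {x : Ident}
    {r : Reg} (hx : γ x = some r) {v : Val} (hr : R' r = v)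
    (hne : ∀ y r', y ≠ x → γ y = some r' → R' r' = R r') :
    Agree γ (Function.update E x (some v)) R' := by
  intro y r' hy
  by_cases hyx : y = x
  · subst hyx
    rw [hx] at hy
    cases hy
    rw [Function.update_self, hr]
  · rw [Function.update_of_ne hyx, hne y r' hyx hy]
    exact h y r' hy

theorem Agree.update {γ : VarMap} {E : Env} {R : RegState} (h : Agree γ E R) (hγ : γ.Injective)
    {x : Ident} {r : Reg} (hx : γ x = some r) (v : Val) :
    Agree γ (Function.update E x (some v)) (Function.update R r v) := by
  refine h.update_var hx (Function.update_self ..) fun y r' hyx hy => ?_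
  refine Function.update_of_ne ?_ _ _
  rintro rfl
  exact hyx (hγ y x r' hy hx)

theorem Agree.reg_eq {γ : VarMap} {E : Env} {R : RegState} (h : Agree γ E R) {x : Ident} {r : Reg}
    {v : Val} (hx : γ x = some r) (hv : E x = some v) : R r = v := by
  have := h x r hx
  rw [hv] at this
  exact (Option.some.inj this).symm

theorem initRegs_of_notMem {rs : List Reg} {r : Reg} (h : r ∉ rs) (vs : List Val) :
    initRegs rs vs r = .undef := by
  induction rs generalizing vs with
  | nil => rfl
  | cons r' rs ih =>
    rw [List.mem_cons, not_or] at h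
    cases vs with
    | nil => rfl
    | cons v vs =>
      simp only [initRegs]
      rw [Function.update_of_ne h.1]
      exact ih h.2 vs

theorem setParams_eq_initRegs {γ : VarMap} (hγ : γ.Injective) {vars params : List Ident}
    {rs : List Reg}
    (h : List.Forall₂ (fun x r => if x ∈ vars then r ∉ VarMap.range γ else γ x = some r) params rs)
    {x : Ident} {r : Reg} (hx : γ x = some r) (hvars : x ∉ vars) (hparams : x ∈ params)
    (vs : List Val) : setParams params vs x = some (initRegs rs vs r) := by
  induction h generalizing vs with
  | nil => simp at hparams
  | @cons y s params rs hys _ ih =>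
    by_cases hxy : x = y
    · subst hxy
      rw [if_neg hvars, hx] at hys
      cases hys
      cases vs <;> simp [setParams, initRegs]
    · have hne : r ≠ s := by
        rintro rfl
        split_ifs at hys with hy
        · exact hys ⟨x, hx⟩
        · exact hxy (hγ x y r hx hys)
      have ih := ih ((List.mem_cons.1 hparams).resolve_left hxy)
      cases vs with
      | nil =>
        simp only [setParams]
        rw [Function.update_of_ne hxy, ih []]
        cases rs <;> rfl
      | cons v vs =>
        simp only [setParams, initRegs]
        rw [Function.update_of_ne hxy, Function.update_of_ne hne, ih vs]

/-- Parameters and local variables agree on entry to a function. A local variable is undefined in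
the source, and its register is none of the parameter registers, so it is `undef` in the target. -/
theorem agree_init {γ : VarMap} (hγ : γ.Injective) {params vars : List Ident} {rs : List Reg}
    (hdom : ∀ x, (γ x).isSome ↔ x ∈ params ∨ x ∈ vars)
    (h : List.Forall₂ (fun x r => if x ∈ vars then r ∉ VarMap.range γ else γ x = some r) params rs)
    (vs : List Val) : Agree γ (initEnv params vars vs) (initRegs rs vs) := by
  intro x r hx
  by_cases hvars : x ∈ vars
  · have hr : r ∉ rs := by
      intro hmem
      obtain ⟨hlen, hget⟩ := List.forall₂_iff_get.1 h
      obtain ⟨i, hi, rfl⟩ := List.mem_iff_getElem.1 hmem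
      have := hget i (hlen ▸ hi) hi
      split_ifs at this with hy
      · exact this ⟨x, hx⟩
      · exact hy (hγ _ _ _ hx this ▸ hvars)
    rw [initEnv, if_pos hvars, initRegs_of_notMem hr]
  · have hparams := ((hdom x).1 (by simp [hx])).resolve_right hvars
    rw [initEnv, if_neg hvars]
    exact setParams_eq_initRegs hγ h hx hvars hparams vs

/-! ### Expressions, conditions and argument lists -/

section Expressions

variable {G : Genv CminorSel.Function} {G' : Genv RTL.Function} {g : Cfg} {γ : VarMap}
  {σ : Block} {E : Env} {M : Mem} {stk : List Frame}

mutual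

theorem trExpr_star (hG : G'.symbol = G.symbol) : (a : Expr) →
    ∀ {π : Set Reg} {rd : Reg} {l₁ l₂ : Node} {R : RegState} {v : Val}, TrExpr g γ π a rd l₁ l₂ → Agree γ E R → EvalExpr G σ E M a v →
    ∃ R', Star (RTL.Step G') (.regular stk g σ l₁ R M) [] (.regular stk g σ l₂ R' M) ∧
      Agree γ E R' ∧ R' rd = v ∧ ∀ r ∈ π, R' r = R r
  | .var id, π, rd, l₁, l₂, R, v, htr, hR, hev => by
    obtain ⟨hv⟩ := hev
    cases htr with
    | var hx => exact ⟨R, .refl _, hR, hR.reg_eq hx hv, fun _ _ => rfl⟩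
    | var_move hx hg hrd =>
      rw [Set.mem_union, not_or] at hrd
      refine ⟨_, .one (.op hg (v := v) ?_), hR.update_temp hrd.1 v, Function.update_self .., ?_⟩
      · simp [evalOp, hR.reg_eq hx hv]
      · exact fun r hr => Function.update_of_ne (ne_of_mem_of_not_mem hr hrd.2) _ _
  | .op o as, π, rd, l₁, l₂, R, v, htr, hR, hev => by
    cases hev with
    | op hevs hv =>
      cases htr with
      | op htrs hg hrd =>
        rw [Set.mem_union, not_or] at hrd
        obtain ⟨R₁, hstar, hR₁, rfl, hπ⟩ := trExprList_star hG as htrs hR hevs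
        refine ⟨_, hstar.silent_snoc (.op hg (by rw [evalOp_congr hG, hv])),
          hR₁.update_temp hrd.1 v, Function.update_self .., fun r hr => ?_⟩
        rw [Function.update_of_ne (ne_of_mem_of_not_mem hr hrd.2), hπ r hr]
  | .load κ m as, π, rd, l₁, l₂, R, v, htr, hR, hev => by
    cases hev with
    | load hevs hm hv =>
      cases htr with
      | load htrs hg hrd =>
        rw [Set.mem_union, not_or] at hrd
        obtain ⟨R₁, hstar, hR₁, rfl, hπ⟩ := trExprList_star hG as htrs hR hevs
        refine ⟨_, hstar.silent_snoc (.load hg (by rw [evalMode_congr hG, hm]) hv),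
          hR₁.update_temp hrd.1 v, Function.update_self .., fun r hr => ?_⟩
        rw [Function.update_of_ne (ne_of_mem_of_not_mem hr hrd.2), hπ r hr]
  | .cond c a₁ a₂, π, rd, l₁, l₂, R, v, htr, hR, hev => by
    cases htr with
    | cond htc htr₁ htr₂ =>
      cases hev with
      | cond_true hc hev =>
        obtain ⟨R₁, hs₁, hR₁, hπ₁⟩ := trCond_star hG c htc hR hc
        obtain ⟨R₂, hs₂, hR₂, hv, hπ₂⟩ := trExpr_star hG a₁ htr₁ hR₁ hev
        exact ⟨R₂, hs₁.silent_trans hs₂, hR₂, hv, fun r hr => (hπ₂ r hr).trans (hπ₁ r hr)⟩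
      | cond_false hc hev =>
        obtain ⟨R₁, hs₁, hR₁, hπ₁⟩ := trCond_star hG c htc hR hc
        obtain ⟨R₂, hs₂, hR₂, hv, hπ₂⟩ := trExpr_star hG a₂ htr₂ hR₁ hev
        exact ⟨R₂, hs₁.silent_trans hs₂, hR₂, hv, fun r hr => (hπ₂ r hr).trans (hπ₁ r hr)⟩

theorem trCond_star (hG : G'.symbol = G.symbol) : (c : CondExpr) →
    ∀ {π : Set Reg} {l₁ ltrue lfalse : Node} {R : RegState} {b : Bool}, TrCond g γ π c l₁ ltrue lfalse → Agree γ E R → EvalCond G σ E M c b →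
    ∃ R', Star (RTL.Step G') (.regular stk g σ l₁ R M) []
        (.regular stk g σ (if b then ltrue else lfalse) R' M) ∧
      Agree γ E R' ∧ ∀ r ∈ π, R' r = R r
  | .tt, π, l₁, ltrue, lfalse, R, b, htr, hR, hev => by
    cases hev
    cases htr
    exact ⟨R, .refl _, hR, fun _ _ => rfl⟩
  | .ff, π, l₁, ltrue, lfalse, R, b, htr, hR, hev => by
    cases hev
    cases htr
    exact ⟨R, .refl _, hR, fun _ _ => rfl⟩
  | .cond c as, π, l₁, ltrue, lfalse, R, b, htr, hR, hev => by
    cases hev with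
    | cond hevs hb =>
      cases htr with
      | cond htrs hg =>
        obtain ⟨R₁, hstar, hR₁, rfl, hπ⟩ := trExprList_star hG as htrs hR hevs
        cases b
        · exact ⟨R₁, hstar.silent_snoc (.cond_false hg hb), hR₁, hπ⟩
        · exact ⟨R₁, hstar.silent_snoc (.cond_true hg hb), hR₁, hπ⟩
  | .ite c₁ c₂ c₃, π, l₁, ltrue, lfalse, R, b, htr, hR, hev => by
    cases htr with
    | ite htr₁ htr₂ htr₃ =>
      cases hev with
      | ite_true hev₁ hev =>
        obtain ⟨R₁, hs₁, hR₁, hπ₁⟩ := trCond_star hG c₁ htr₁ hR hev₁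
        obtain ⟨R₂, hs₂, hR₂, hπ₂⟩ := trCond_star hG c₂ htr₂ hR₁ hev
        exact ⟨R₂, hs₁.silent_trans hs₂, hR₂, fun r hr => (hπ₂ r hr).trans (hπ₁ r hr)⟩
      | ite_false hev₁ hev =>
        obtain ⟨R₁, hs₁, hR₁, hπ₁⟩ := trCond_star hG c₁ htr₁ hR hev₁
        obtain ⟨R₂, hs₂, hR₂, hπ₂⟩ := trCond_star hG c₃ htr₃ hR₁ hev
        exact ⟨R₂, hs₁.silent_trans hs₂, hR₂, fun r hr => (hπ₂ r hr).trans (hπ₁ r hr)⟩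

theorem trExprList_star (hG : G'.symbol = G.symbol) : (as : ExprList) →
    ∀ {π : Set Reg} {rs : List Reg} {l₁ l₂ : Node} {R : RegState} {vs : List Val}, TrExprList g γ π as rs l₁ l₂ → Agree γ E R →
    EvalExprList G σ E M as vs →
    ∃ R', Star (RTL.Step G') (.regular stk g σ l₁ R M) [] (.regular stk g σ l₂ R' M) ∧
      Agree γ E R' ∧ rs.map R' = vs ∧ ∀ r ∈ π, R' r = R r
  | .nil, π, rs, l₁, l₂, R, vs, htr, hR, hev => by
    cases hev
    cases htr
    exact ⟨R, .refl _, hR, rfl, fun _ _ => rfl⟩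
  | .cons a as, π, rs, l₁, l₂, R, vs, htr, hR, hev => by
    cases hev with
    | cons hev hevs =>
      cases htr with
      | cons htr htrs =>
        obtain ⟨R₁, hs₁, hR₁, rfl, hπ₁⟩ := trExpr_star hG a htr hR hev
        obtain ⟨R₂, hs₂, hR₂, rfl, hπ₂⟩ := trExprList_star hG as htrs hR₁ hevs
        refine ⟨R₂, hs₁.silent_trans hs₂, hR₂, ?_, fun r hr => ?_⟩
        · rw [List.map_cons, hπ₂ _ (Or.inr rfl)]
        · rw [hπ₂ r (Or.inl hr), hπ₁ r hr]

end

end Expressions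

/-! ### Decision trees, results of calls, labels -/

theorem trTree_star {G' : Genv RTL.Function} {g : Cfg} {σ : Block} {M : Mem} {stk : List Frame}
    {R : RegState} {r : Reg} {le : List Node} {t : DecTree} {l : Node} {x : Int32}
    (h : TrTree g r le t l) (hr : R r = .int x) :
    ∃ l', le[t.target x]? = some l' ∧
      Star (RTL.Step G') (.regular stk g σ l R M) [] (.regular stk g σ l' R M) := by
  induction h with
  | action h => exact ⟨_, h, .refl _⟩
  | @ifeq i n t l lfound lnext hg hn _ ih =>
    have hev : evalCond (.compimm .eq i) ([r].map R) = some (decide (x = i)) := by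
      simp [evalCond, hr, Comparison.eval, BitVec.toInt_inj]
    by_cases hx : x = i
    · rw [decide_eq_true hx] at hev
      exact ⟨lfound, by rw [DecTree.target, if_pos hx, hn], .one (.cond_true hg hev)⟩
    · rw [decide_eq_false hx] at hev
      obtain ⟨l', hl', hstar⟩ := ih
      exact ⟨l', by rw [DecTree.target, if_neg hx, hl'], .step (.cond_false hg hev) hstar⟩
  | @iflt i t₁ t₂ l l₁ l₂ hg _ _ ih₁ ih₂ =>
    have hev : evalCond (.compuimm .lt i) ([r].map R) = some (decide (x.toNat < i.toNat)) := by
      simp [evalCond, hr, Comparison.eval]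
    by_cases hx : x.toNat < i.toNat
    · rw [decide_eq_true hx] at hev
      obtain ⟨l', hl', hstar⟩ := ih₁
      exact ⟨l', by rw [DecTree.target, if_pos hx, hl'], .step (.cond_true hg hev) hstar⟩
    · rw [decide_eq_false hx] at hev
      obtain ⟨l', hl', hstar⟩ := ih₂
      exact ⟨l', by rw [DecTree.target, if_neg hx, hl'], .step (.cond_false hg hev) hstar⟩

/-- After the return instruction has put `v` in `r`, the code that follows the call completes the
assignment of `v` to the result variable. -/
theorem trResult_star {G' : Genv RTL.Function} {g : Cfg} {γ : VarMap} {σ : Block} {E : Env}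
    {M : Mem} {stk : List Frame} {R : RegState} {r : Reg} {id : Option Ident} {l l₂ : Node}
    (h : TrResult g γ r id l l₂) (hγ : γ.Injective) (hR : Agree γ E R) (v : Val) :
    ∃ R', Star (RTL.Step G') (.regular stk g σ l (Function.update R r v) M) []
        (.regular stk g σ l₂ R' M) ∧ Agree γ (setOpt E id v) R' := by
  cases h with
  | unused hr => exact ⟨_, .refl _, hR.update_temp hr v⟩
  | direct hx => exact ⟨_, .refl _, hR.update hγ hx v⟩
  | move hr hx hg =>
    exact ⟨_, .one (.op hg (v := v) (by simp [evalOp])), (hR.update_temp hr v).update hγ hx v⟩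

theorem TrCont.matchStack_callcont {g : Cfg} {γ : VarMap} {lg : LabelMap} {lr : Node}
    {rr : Option Reg} : (k : Cont) → ∀ {l₂ : Node} {le : List Node} {stk : List Frame},
    TrCont g γ lg lr rr k l₂ le stk → MatchStack (CminorSel.callcont k) stk
  | .halt, _, _, _, h => by
    cases h with
    | callcont _ h => exact h
  | .returnto .., _, _, _, h => by
    cases h with
    | callcont _ h => exact h
  | .seq s k, _, _, _, h => by
    cases h with
    | seq _ h => exact TrCont.matchStack_callcont k h
    | callcont _ h => cases h
  | .endblock k, _, _, _, h => by
    cases h with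
    | endblock h => exact TrCont.matchStack_callcont k h
    | callcont _ h => cases h

/-- The statement and the continuation found for a label have translations, reached by one `nop`
from the node of the label. Only that node is determined by `lbl`, not the translations of `s'`
and `k'`, hence the existential nodes. -/
theorem findlabel_trStmt {g : Cfg} {γ : VarMap} {lg : LabelMap} {lr : Node} {rr : Option Reg}
    {stk : List Frame} {lbl : Label} {s s' : Stmt} {k k' : Cont} {l₁ l₂ : Node} {le : List Node}
    (hs : TrStmt g γ lg lr rr s l₁ l₂ le) (hk : TrCont g γ lg lr rr k l₂ le stk)
    (hfind : findlabel lbl s k = some (s', k')) :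
    ∃ l l₁' l₂' le', lg lbl = some l ∧ g.lookup l = some (.nop l₁') ∧
      TrStmt g γ lg lr rr s' l₁' l₂' le' ∧ TrCont g γ lg lr rr k' l₂' le' stk := by
  induction hs generalizing k with
  | seq hs₁ hs₂ ih₁ ih₂ =>
    rw [findlabel] at hfind
    split at hfind
    next h =>
      rw [hfind] at h
      exact ih₁ (.seq hs₂ hk) h
    next => exact ih₂ hk hfind
  | ifte _ _ _ ih₁ ih₂ =>
    rw [findlabel] at hfind
    split at hfind
    next h =>
      rw [hfind] at h
      exact ih₁ hk h
    next => exact ih₂ hk hfind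
  | loop hg hs ih =>
    rw [findlabel] at hfind
    exact ih (.seq (.loop hg hs) hk) hfind
  | block _ ih =>
    rw [findlabel] at hfind
    exact ih (.endblock hk) hfind
  | label hl hg hs ih =>
    rw [findlabel] at hfind
    split_ifs at hfind with h
    · subst h
      cases hfind
      exact ⟨_, _, _, _, hl, hg, hs, hk⟩
    · exact ih hk hfind
  | _ => simp [findlabel] at hfind

/-! ### Simulation of one step -/

theorem _root_.Compcert.CminorSel.Expr.size_pos (a : Expr) : 0 < a.size := by
  cases a <;> simp only [Expr.size] <;> omega

theorem measure_lt_of_size_lt {F F' : CminorSel.Function} {s s' : Stmt} {k k' : Cont}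
    {σ σ' : Block} {E E' : Env} {M M' : Mem} (h : s'.size + k'.size < s.size + k.size) :
    (CminorSel.State.regular F' s' k' σ' E' M').measure <
      (CminorSel.State.regular F s k σ E M).measure :=
  Prod.Lex.toLex_lt_toLex.2 (.inl h)

/-- The focus moves into a statement while the total size stays the same. -/
theorem measure_lt_of_size_eq {F F' : CminorSel.Function} {s s' : Stmt} {k k' : Cont}
    {σ σ' : Block} {E E' : Env} {M M' : Mem} (h : s'.size + k'.size = s.size + k.size)
    (hs : s'.size < s.size) :
    (CminorSel.State.regular F' s' k' σ' E' M').measure <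
      (CminorSel.State.regular F s k σ E M).measure :=
  Prod.Lex.toLex_lt_toLex.2 (.inr ⟨h, hs⟩)

theorem TrBody.rr_eq_none {g : Cfg} {γ : VarMap} {lg : LabelMap} {lr l₁ : Node} {rr : Option Reg}
    {F : CminorSel.Function} (h : TrBody g γ lg lr rr F l₁) (hres : F.sig.res = none) :
    rr = none := by
  have := h.ret_sig
  simpa [hres] using this

theorem TrStmt.exit_inv {g : Cfg} {γ : VarMap} {lg : LabelMap} {lr l₁ l₂ : Node} {rr : Option Reg}
    {n : ℕ} {le : List Node} (h : TrStmt g γ lg lr rr (.exit n) l₁ l₂ le) : le[n]? = some l₁ := by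
  cases h
  assumption

theorem step_simulation {P : CminorSel.Program} {P' : RTL.Program} (hP : TrProgram P P')
    {S₁ S₂ : CminorSel.State} {S₁' : RTL.State} {t : Trace}
    (hstep : CminorSel.Step (globalenv P) S₁ t S₂) (hmatch : MatchStates S₁ S₁') :
    (∃ S₂', Plus (RTL.Step (globalenv P')) S₁' t S₂' ∧ MatchStates S₂ S₂') ∨
    (S₂.measure < S₁.measure ∧
      ∃ S₂', Star (RTL.Step (globalenv P')) S₁' t S₂' ∧ MatchStates S₂ S₂') := by
  have hG := hP.symbol
  cases hstep with
  | skip_seq =>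
    obtain ⟨hb, ⟨⟩, hk, hR⟩ := hmatch
    cases hk with
    | seq hs hk =>
      refine .inr ⟨measure_lt_of_size_lt ?_, _, .refl _, .regular hb hs hk hR⟩
      simp only [Stmt.size, Cont.size]; omega
    | callcont _ h => cases h
  | skip_endblock =>
    obtain ⟨hb, ⟨⟩, hk, hR⟩ := hmatch
    cases hk with
    | endblock hk =>
      refine .inr ⟨measure_lt_of_size_lt ?_, _, .refl _, .regular hb .skip hk hR⟩
      simp only [Stmt.size, Cont.size]; omega
    | callcont _ h => cases h
  | @assign _ id a k _ _ _ v hev =>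
    obtain ⟨hb, hs, hk, hR⟩ := hmatch
    cases hs with
    | assign hx htr =>
      obtain ⟨R', hstar, hR', hv, -⟩ := trExpr_star hG a htr hR hev
      refine .inr ⟨measure_lt_of_size_lt ?_, _, hstar, .regular hb .skip hk
        (hR'.update_var hx hv fun _ _ _ _ => rfl)⟩
      -- `a` may be evaluated directly into the register of the variable, without any instruction.
      have := a.size_pos
      simp only [Stmt.size]; omega
    | assign_move hx htr hg =>
      obtain ⟨R', hstar, hR', rfl, -⟩ := trExpr_star hG a htr hR hev
      exact .inl ⟨_, hstar.silent_plus (.op hg rfl),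
        .regular hb .skip hk (hR'.update hb.injective hx _)⟩
  | store hevs hm hev hst =>
    obtain ⟨hb, hs, hk, hR⟩ := hmatch
    cases hs with
    | store htrs htr hg =>
      obtain ⟨R₁, hs₁, hR₁, rfl, -⟩ := trExprList_star hG _ htrs hR hevs
      obtain ⟨R₂, hs₂, hR₂, rfl, hπ⟩ := trExpr_star hG _ htr hR₁ hev
      refine .inl ⟨_, (hs₁.silent_trans hs₂).silent_plus (.store hg ?_ hst),
        .regular hb .skip hk hR₂⟩
      rw [List.map_congr_left hπ, evalMode_congr hG, hm]
  | seq =>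
    obtain ⟨hb, hs, hk, hR⟩ := hmatch
    cases hs with
    | seq hs₁ hs₂ =>
      refine .inr ⟨measure_lt_of_size_eq ?_ ?_, _, .refl _, .regular hb hs₁ (.seq hs₂ hk) hR⟩
      all_goals simp only [Stmt.size, Cont.size]; omega
  | if_true hev =>
    obtain ⟨hb, hs, hk, hR⟩ := hmatch
    cases hs with
    | ifte htr hs₁ hs₂ =>
      obtain ⟨R', hstar, hR', -⟩ := trCond_star hG _ htr hR hev
      refine .inr ⟨measure_lt_of_size_lt ?_, _, hstar, .regular hb hs₁ hk hR'⟩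
      simp only [Stmt.size]; omega
  | if_false hev =>
    obtain ⟨hb, hs, hk, hR⟩ := hmatch
    cases hs with
    | ifte htr hs₁ hs₂ =>
      obtain ⟨R', hstar, hR', -⟩ := trCond_star hG _ htr hR hev
      refine .inr ⟨measure_lt_of_size_lt ?_, _, hstar, .regular hb hs₂ hk hR'⟩
      simp only [Stmt.size]; omega
  | loop =>
    obtain ⟨hb, hs, hk, hR⟩ := hmatch
    cases hs with
    | loop hg hs => exact .inl ⟨_, .one (.nop hg), .regular hb hs (.seq (.loop hg hs) hk) hR⟩
  | block =>
    obtain ⟨hb, hs, hk, hR⟩ := hmatch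
    cases hs with
    | block hs =>
      refine .inr ⟨measure_lt_of_size_eq ?_ ?_, _, .refl _, .regular hb hs (.endblock hk) hR⟩
      all_goals simp only [Stmt.size, Cont.size]; omega
  | exit_seq =>
    obtain ⟨hb, hs, hk, hR⟩ := hmatch
    have hn := hs.exit_inv
    cases hk with
    | seq hs hk =>
      refine .inr ⟨measure_lt_of_size_lt ?_, _, .refl _, .regular hb (.exit hn) hk hR⟩
      simp only [Stmt.size, Cont.size]; omega
    | callcont _ h => cases h
  | exit_zero =>
    obtain ⟨hb, hs, hk, hR⟩ := hmatch
    have hn := hs.exit_inv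
    cases hk with
    | endblock hk =>
      cases hn
      refine .inr ⟨measure_lt_of_size_lt ?_, _, .refl _, .regular hb .skip hk hR⟩
      simp only [Stmt.size, Cont.size]; omega
    | callcont _ h => cases h
  | exit_succ =>
    obtain ⟨hb, hs, hk, hR⟩ := hmatch
    have hn := hs.exit_inv
    cases hk with
    | endblock hk =>
      rw [List.getElem?_cons_succ] at hn
      refine .inr ⟨measure_lt_of_size_lt ?_, _, .refl _, .regular hb (.exit hn) hk hR⟩
      simp only [Stmt.size, Cont.size]; omega
    | callcont _ h => cases h
  | @switch _ a tbl _ _ _ _ n hev =>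
    obtain ⟨hb, hs, hk, hR⟩ := hmatch
    cases hs with
    | switch htarget htr htree =>
      obtain ⟨R', hs₁, hR', hv, -⟩ := trExpr_star hG a htr hR hev
      obtain ⟨l', hl', hs₂⟩ := trTree_star htree hv
      rw [htarget] at hl'
      refine .inr ⟨measure_lt_of_size_lt ?_, _, hs₁.silent_trans hs₂,
        .regular hb (.exit hl') hk hR'⟩
      have := a.size_pos
      simp only [Stmt.size]; omega
  | label =>
    obtain ⟨hb, hs, hk, hR⟩ := hmatch
    cases hs with
    | label _ _ hs =>
      refine .inr ⟨measure_lt_of_size_lt ?_, _, .refl _, .regular hb hs hk hR⟩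
      simp only [Stmt.size]; omega
  | goto hfind =>
    obtain ⟨hb, hs, hk, hR⟩ := hmatch
    cases hs with
    | goto hl =>
      obtain ⟨l, l₁, l₂, le, hl', hg, hs', hk'⟩ :=
        findlabel_trStmt hb.body (.callcont hb.ret (hk.matchStack_callcont)) hfind
      obtain rfl := Option.some.inj (hl.symm.trans hl')
      exact .inl ⟨_, .one (.nop hg), .regular hb hs' hk' hR⟩
  | call hev hevs hfun hsig =>
    obtain ⟨hb, hs, hk, hR⟩ := hmatch
    cases hs with
    | call htr htrs hg hres =>
      obtain ⟨R₁, hs₁, hR₁, hv, -⟩ := trExpr_star hG _ htr hR hev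
      obtain ⟨R₂, hs₂, hR₂, rfl, hπ⟩ := trExprList_star hG _ htrs hR₁ hevs
      obtain ⟨Fd', hfun', hFd⟩ := hP.funct hfun
      refine .inl ⟨_, (hs₁.silent_trans hs₂).silent_plus
        (.call hg (.reg ((hπ _ rfl).trans hv)) hfun' (hFd.sig.trans hsig)),
        .call hFd (.returnto hb hR₂ hres hk)⟩
  | tailcall hev hevs hfun hsig =>
    obtain ⟨hb, hs, hk, hR⟩ := hmatch
    cases hs with
    | tailcall htr htrs hg =>
      obtain ⟨R₁, hs₁, hR₁, hv, -⟩ := trExpr_star hG _ htr hR hev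
      obtain ⟨R₂, hs₂, hR₂, rfl, hπ⟩ := trExprList_star hG _ htrs hR₁ hevs
      obtain ⟨Fd', hfun', hFd⟩ := hP.funct hfun
      refine .inl ⟨_, (hs₁.silent_trans hs₂).silent_plus
        (.tailcall hg (.reg ((hπ _ rfl).trans hv)) hfun' (hFd.sig.trans hsig)),
        .call hFd hk.matchStack_callcont⟩
  | skip_return hres hcall =>
    obtain ⟨hb, ⟨⟩, hk, hR⟩ := hmatch
    cases hk with
    | seq => exact hcall.elim
    | endblock => exact hcall.elim
    | callcont hg hk =>
      rw [hb.rr_eq_none hres] at hg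
      exact .inl ⟨_, .one (.return_none hg), .ret hk⟩
  | return_none hres =>
    obtain ⟨hb, hs, hk, hR⟩ := hmatch
    cases hs with
    | return_none =>
      have hg := hb.ret
      rw [hb.rr_eq_none hres] at hg
      exact .inl ⟨_, .one (.return_none hg), .ret hk.matchStack_callcont⟩
  | return_some hres hev =>
    obtain ⟨hb, hs, hk, hR⟩ := hmatch
    cases hs with
    | return_some hrr htr =>
      obtain ⟨R', hstar, -, rfl, -⟩ := trExpr_star hG _ htr hR hev
      exact .inl ⟨_, hstar.silent_plus (.return_some (hrr ▸ hb.ret)), .ret hk.matchStack_callcont⟩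
  | internal halloc =>
    obtain - | ⟨hFd, hk⟩ := hmatch
    cases hFd with
    | internal hF =>
      obtain ⟨γ, lg, lr, rr, hb, hdom, hparams⟩ := hF.body
      exact .inl ⟨_, .one (.internal (by rw [hF.stacksize, halloc])),
        .regular hb hb.body (.callcont hb.ret hk) (agree_init hb.injective hdom hparams _)⟩
  | external hext =>
    obtain - | ⟨hFd, hk⟩ := hmatch
    cases hFd
    exact .inl ⟨_, .one (.external hext), .ret hk⟩
  | ret =>
    obtain - | - | hk := hmatch
    cases hk with
    | returnto hb hR hres hk =>
      obtain ⟨R', hstar, hR'⟩ := trResult_star hres hb.injective hR _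
      exact .inl ⟨_, .mk .ret hstar, .regular hb .skip hk hR'⟩

/-! ### Preservation of behaviors -/

theorem star_simulation {P : CminorSel.Program} {P' : RTL.Program} (hP : TrProgram P P')
    {S₁ S₂ : CminorSel.State} {S₁' : RTL.State} {t : Trace}
    (hstar : Star (CminorSel.Step (globalenv P)) S₁ t S₂) (hmatch : MatchStates S₁ S₁') :
    ∃ S₂', Star (RTL.Step (globalenv P')) S₁' t S₂' ∧ MatchStates S₂ S₂' := by
  induction hstar generalizing S₁' with
  | refl => exact ⟨_, .refl _, hmatch⟩
  | step hstep _ ih =>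
    obtain ⟨S', h₁, hmatch'⟩ : ∃ S', Star (RTL.Step (globalenv P')) S₁' _ S' ∧ _ := by
      obtain ⟨S', h, hm⟩ | ⟨-, S', h, hm⟩ := step_simulation hP hstep hmatch
      · exact ⟨S', h.star, hm⟩
      · exact ⟨S', h, hm⟩
    obtain ⟨S'', h₂, hmatch''⟩ := ih hmatch'
    exact ⟨S'', h₁.trans h₂, hmatch''⟩

/-- A target state related to a diverging source state makes progress, by induction on the measure
of the source state. -/
theorem forever_plus {P : CminorSel.Program} {P' : RTL.Program} (hP : TrProgram P P')
    (S : CminorSel.State) {S' : RTL.State} {T : InfTrace} (hmatch : MatchStates S S')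
    (hS : Forever (CminorSel.Step (globalenv P)) S T) :
    ∃ t S₁' T', Plus (RTL.Step (globalenv P')) S' t S₁' ∧
      T = Stream'.Seq.append (Stream'.Seq.ofList t) T' ∧
      ∃ S₁, MatchStates S₁ S₁' ∧ Forever (CminorSel.Step (globalenv P)) S₁ T' := by
  induction h : S.measure using WellFoundedLT.induction generalizing S S' T with
  | ind m ih =>
    obtain ⟨t, S₁, T₁, hstep, rfl, hS₁⟩ := hS.unfold
    obtain ⟨S₁', hplus, hm⟩ | ⟨hlt, S₁', hstar, hm⟩ := step_simulation hP hstep hmatch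
    · exact ⟨t, S₁', T₁, hplus, rfl, S₁, hm, hS₁⟩
    · obtain ⟨t₂, S₂', T₂, hplus, rfl, hS₂⟩ := ih _ (h ▸ hlt) S₁ hm hS₁ rfl
      exact ⟨t ++ t₂, S₂', T₂, hstar.trans_plus hplus, (ofList_append_append _ _ _).symm, hS₂⟩

theorem forever_simulation {P : CminorSel.Program} {P' : RTL.Program} (hP : TrProgram P P')
    {S : CminorSel.State} {S' : RTL.State} {T : InfTrace} (hmatch : MatchStates S S')
    (hS : Forever (CminorSel.Step (globalenv P)) S T) :
    Forever (RTL.Step (globalenv P')) S' T :=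
  forever_of_plus
    (X := fun S' T => ∃ S, MatchStates S S' ∧ Forever (CminorSel.Step (globalenv P)) S T)
    (fun _ _ ⟨S, hm, hS⟩ => forever_plus hP S hm hS) ⟨S, hmatch, hS⟩

theorem initial_simulation {P : CminorSel.Program} {P' : RTL.Program} (hP : TrProgram P P')
    {S : CminorSel.State} (hS : CminorSel.Initial P S) :
    ∃ S', RTL.Initial P' S' ∧ MatchStates S S' := by
  obtain ⟨hsym, hfun⟩ := hS
  obtain ⟨Fd', hfun', hFd⟩ := hP.funct hfun
  refine ⟨_, .mk (by rw [hP.symbol, hP.main, hsym]) hfun', ?_⟩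
  rw [hP.initmem]
  exact .call hFd .halt

theorem final_simulation {S : CminorSel.State} {S' : RTL.State} {n : Int32}
    (hmatch : MatchStates S S') (hS : CminorSel.Final S n) : RTL.Final S' n := by
  obtain ⟨⟩ := hS
  obtain - | - | ⟨⟨⟩⟩ := hmatch
  exact .mk

theorem behaves_preserved {P : CminorSel.Program} {P' : RTL.Program} (hP : TrProgram P P')
    {B : Behavior} (hB : B ∉ Wrong) (h : (CminorSel.semantics P).Behaves B) :
    (RTL.semantics P').Behaves B := by
  cases h with
  | converges hinit hstar hfinal =>
    obtain ⟨S₁', hinit', hm₁⟩ := initial_simulation hP hinit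
    obtain ⟨S₂', hstar', hm₂⟩ := star_simulation hP hstar hm₁
    exact .converges (L := RTL.semantics P') hinit' hstar' (final_simulation hm₂ hfinal)
  | diverges hinit hforever =>
    obtain ⟨S₁', hinit', hm₁⟩ := initial_simulation hP hinit
    exact .diverges (L := RTL.semantics P') hinit' (forever_simulation hP hm₁ hforever)
  | goeswrong => exact (hB ⟨_, rfl⟩).elim

end RTLgen

end Compcert

theorem lemmal (P : Compcert.CminorSel.Program) (P' : Compcert.RTL.Program)
    (hP : Compcert.RTLgen.TrProgram P P') :
    (∀ (S₁ S₂ : Compcert.CminorSel.State) (S₁' : Compcert.RTL.State) (t : Compcert.Trace),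
      Compcert.CminorSel.Step (Compcert.globalenv P) S₁ t S₂ →
      Compcert.RTLgen.MatchStates S₁ S₁' →
      (∃ S₂', Compcert.Plus (Compcert.RTL.Step (Compcert.globalenv P')) S₁' t S₂' ∧
        Compcert.RTLgen.MatchStates S₂ S₂') ∨
      (S₂.measure < S₁.measure ∧
        ∃ S₂', Compcert.Star (Compcert.RTL.Step (Compcert.globalenv P')) S₁' t S₂' ∧
          Compcert.RTLgen.MatchStates S₂ S₂')) ∧
    (∀ B : Compcert.Behavior, B ∉ Compcert.Wrong →
      (Compcert.CminorSel.semantics P).Behaves B → (Compcert.RTL.semantics P').Behaves B) :=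
  ⟨fun _ _ _ _ hstep hmatch => Compcert.RTLgen.step_simulation hP hstep hmatch,
    fun _ hB h => Compcert.RTLgen.behaves_preserved hP hB h⟩
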